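/- Let $N\ge 1$ and let $\Lambda=\Lambda_{2N}$ be any $2$-graph with vertices $v,u_1,\dots,u_N,w_1,\dots,w_N$ which has, in each of the two colours red and blue, exactly one edge from $v$ to each $u_j$ and to each $w_j$, exactly one edge from each $u_j$ and from each $w_j$ to $v$, and no other edges (the factorization rules are arbitrary). Give the infinite path space $\Lambda^\infty$ the topology generated by the cylinder sets $Z(\lambda)=\{x\in\Lambda^\infty : x(0,d(\lambda))=\lambda\}$, and its Borel $\sigma$-algebra. Let $(\delta^j_i)_{i\in\mathbb N}$, $j=1,\dots,N$, be real sequences with $|\delta^j_i|<1$ for all $i,j$ and $\sum_i|\delta^j_i|<\infty$ for all $j$. For a path $\eta$ of degree $(n,n)$, $n \ge 0$, let $Q_0,Q_1,\dots,Q_{2n}$ be the vertices which $\eta$ passes through when it is written, starting from its range, as an alternating string of red and blue edges beginning with a red edge, and put $\alpha_i=\delta^j_i$ if $Q_i=u_j$ and $\alpha_i=-\delta^j_i$ if $Q_i=w_j$. Let $M$ denote the Perron--Frobenius measure on $\Lambda^\infty$, $M(Z(\lambda))=\rho_1^{-d(\lambda)_1}\rho_2^{-d(\lambda)_2}\,\kappa_{s(\lambda)}$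 for all $\lambda\in\Lambda$, where $\rho_i$ is the spectral radius of the vertex matrix $A_i$ and $\kappa$ is the unique positive vector with $\sum_x\kappa_x=1$ and $A_i\kappa=\rho_i\kappa$ for $i=1,2$. The measure $M$ exists and is unique, and the following hold. (1) There is a unique Borel measure $\mu_{2N}$ on $\Lambda^\infty$ such that for all $n\ge 0$ and all $\eta$ of degree $(n,n)$ $$\mu_{2N}(Z(\eta))=\begin{cases}\prod_{i=1}^{n}\frac{1+\alpha_{2i-1}}{2N}, & r(\eta)=v,\\[2pt] \prod_{i=0}^{n}\frac{1+\alpha_{2i}}{2N}, & r(\eta)\neq v,\end{cases}$$ and $\mu_{2N}$ is equivalent to $M$, that is, $\mu_{2N}\ll M\ll\mu_{2N}$. (2) The standard prefixing maps $\sigma_\lambda: Z(s(\lambda))\to \Lambda^\infty$, $x\mapsto\lambda x$, and coding maps $\sigma^n(x)(p,q)=x(p+n,q+n)$ make $(\Lambda^\infty,\mu_{2N})$ into a $\Lambda$-semibranching function system, and likewise $(\Lambda^\infty,M)$. Here a $\Lambda$-semibranching function system on a measure space $(X,\mu)$ consists of measurable sets $D_\lambda\subseteq X$, measurable maps $\tau_\lambda:D_\lambda\to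 X$ ($\lambda\in\Lambda$) with ranges $R_\lambda=\tau_\lambda(D_\lambda)$, and measurable maps $\tau^m:X\to X$ ($m\in\mathbb N^2$) such that: for each $m$, the sets $R_\lambda$ with $d(\lambda)=m$ cover $X$ and are pairwise disjoint up to null sets, and for $d(\lambda)=m$ the Radon--Nikodym derivative $\frac{d(\mu\circ\tau_\lambda)}{d\mu}$ exists and is positive a.e. on $D_\lambda$, and $\tau^m\circ\tau_\lambda=\mathrm{id}_{D_\lambda}$; for each vertex $x$, $\tau_x=\mathrm{id}$ and $\mu(D_x)>0$; if $s(\lambda)=r(\nu)$ then, up to null sets, $R_\nu\subseteq D_\lambda$, $D_{\lambda\nu}=D_\nu$ and $\tau_\lambda\tau_\nu=\tau_{\lambda\nu}$; and $\tau^m\circ\tau^n=\tau^{m+n}$. In (2), $D_\lambda=Z(s(\lambda))$, $\tau_\lambda=\sigma_\lambda$ and $\tau^m=\sigma^m$. $C^*(\Lambda)$ is the universal C*-algebra generated by a Cuntz--Krieger $\Lambda$-family $(t_\lambda)_{\lambda\in\Lambda}$. (3) For $\mu\in\{\mu_{2N},M\}$ there is a unique representation $\pi_\mu$ of $C^*(\Lambda)$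 on $L^2(\Lambda^\infty,\mu)$ with $$\pi_\mu(t_\lambda)\xi(x)=\chi_{Z(\lambda)}(x)\,\Big(\frac{d(\mu\circ\sigma_\lambda)}{d\mu}\big(\sigma^{d(\lambda)}(x)\big)\Big)^{-1/2}\xi\big(\sigma^{d(\lambda)}(x)\big),\qquad \lambda\in\Lambda,$$ where the $t_\lambda$ are the canonical generators of $C^*(\Lambda)$, and $\pi_{\mu_{2N}}$ is unitarily equivalent to $\pi_M$. -/

import Mathlib

open MeasureTheory Set
open scoped ENNReal

noncomputable section

/-! ### Higher-rank graphs -/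

/-- A `k`-graph with vertex set `V` and set of paths (morphisms) `P`: a countable small category,
presented by its arrows, with a degree functor `d` to `ℕᵏ` that has the factorization property.
A path `a` goes from its source `s a` to its range `r a`; the product `a b` is defined when
`s a = r b`, and is written `comp a b h`. -/
structure KGraph (k : ℕ) (V : Type*) (P : Type*) where
  r : P → V
  s : P → V
  d : P → (Fin k → ℕ)
  idp : V → P
  comp : (a b : P) → s a = r b → P
  r_idp : ∀ v, r (idp v) = v
  s_idp : ∀ v, s (idp v) = v
  r_comp : ∀ a b h, r (comp a b h) = r a
  s_comp : ∀ a b h, s (comp a b h) = s b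
  idp_comp : ∀ a, comp (idp (r a)) a (s_idp (r a)) = a
  comp_idp : ∀ a, comp a (idp (s a)) (r_idp (s a)).symm = a
  comp_assoc : ∀ a b c (hab : s a = r b) (hbc : s b = r c),
    comp (comp a b hab) c ((s_comp a b hab).trans hbc)
      = comp a (comp b c hbc) (hab.trans (r_comp b c hbc).symm)
  d_idp : ∀ v, d (idp v) = 0
  d_comp : ∀ a b h, d (comp a b h) = d a + d b
  factorization : ∀ (a : P) (m n : Fin k → ℕ), d a = m + n →
    ∃! bc : P × P, (∃ h : s bc.1 = r bc.2, comp bc.1 bc.2 h = a) ∧ d bc.1 = m ∧ d bc.2 = n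
  countable : Countable P

namespace KGraph

variable {k : ℕ} {V P : Type*} (Λ : KGraph k V P)

theorem exists_factor (a : P) (p : Fin k → ℕ) (hp : p ≤ Λ.d a) :
    ∃ bc : P × P, (∃ h : Λ.s bc.1 = Λ.r bc.2, Λ.comp bc.1 bc.2 h = a) ∧ Λ.d bc.1 = p :=
  let ⟨bc, hbc, _⟩ := Λ.factorization a p (Λ.d a - p) (add_tsub_cancel_of_le hp).symm
  ⟨bc, hbc.1, hbc.2.1⟩

open Classical in
/-- The initial piece `a(0, p)` of degree `p` of a path `a` with `p ≤ d a` (and `a` itself if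
not `p ≤ d a`). -/
def head (a : P) (p : Fin k → ℕ) : P :=
  if hp : p ≤ Λ.d a then (Λ.exists_factor a p hp).choose.1 else a

open Classical in
/-- The remaining piece `a(p, d a)` of a path `a` with `p ≤ d a` (and `a` itself if
not `p ≤ d a`). -/
def tail (a : P) (p : Fin k → ℕ) : P :=
  if hp : p ≤ Λ.d a then (Λ.exists_factor a p hp).choose.2 else a

/-- The vertex `a(p, p)` that the path `a` passes through at position `p ≤ d a`. -/
def vertexAt (a : P) (p : Fin k → ℕ) : V := Λ.s (Λ.head a p)

theorem head_tail (a : P) (p : Fin k → ℕ) (hp : p ≤ Λ.d a) :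
    (∃ h : Λ.s (Λ.head a p) = Λ.r (Λ.tail a p), Λ.comp (Λ.head a p) (Λ.tail a p) h = a) ∧
      Λ.d (Λ.head a p) = p := by
  have := (Λ.exists_factor a p hp).choose_spec
  simpa only [head, tail, dif_pos hp] using this

theorem comp_inj {a b a' b' : P} (h : Λ.s a = Λ.r b) (h' : Λ.s a' = Λ.r b')
    (e : Λ.comp a b h = Λ.comp a' b' h') (hd : Λ.d a = Λ.d a') : a = a' ∧ b = b' := by
  have hdb : Λ.d b = Λ.d b' := by
    have := congrArg Λ.d e
    rw [Λ.d_comp, Λ.d_comp, hd] at this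
    exact add_left_cancel this
  have := (Λ.factorization (Λ.comp a b h) _ _ (Λ.d_comp a b h)).unique
    (y₁ := (a, b)) (y₂ := (a', b')) ⟨⟨h, rfl⟩, rfl, rfl⟩ ⟨⟨h', e.symm⟩, hd.symm, hdb.symm⟩
  exact ⟨congrArg Prod.fst this, congrArg Prod.snd this⟩

theorem tail_comp (a b : P) (h : Λ.s a = Λ.r b) : Λ.tail (Λ.comp a b h) (Λ.d a) = b := by
  obtain ⟨⟨h1, h2⟩, h3⟩ := Λ.head_tail (Λ.comp a b h) (Λ.d a)
    (by rw [Λ.d_comp]; exact le_self_add)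
  exact (Λ.comp_inj h1 h h2 h3).2

theorem head_comp (a b : P) (h : Λ.s a = Λ.r b) : Λ.head (Λ.comp a b h) (Λ.d a) = a := by
  obtain ⟨⟨h1, h2⟩, h3⟩ := Λ.head_tail (Λ.comp a b h) (Λ.d a)
    (by rw [Λ.d_comp]; exact le_self_add)
  exact (Λ.comp_inj h1 h h2 h3).1

theorem comp_congr {a b a' b' : P} (ha : a = a') (hb : b = b') (h : Λ.s a = Λ.r b)
    (h' : Λ.s a' = Λ.r b') : Λ.comp a b h = Λ.comp a' b' h' := by
  subst ha hb; rfl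

theorem eq_idp {a : P} (h : Λ.d a = 0) : a = Λ.idp (Λ.r a) :=
  (Λ.comp_inj (Λ.r_idp _).symm (Λ.s_idp _)
    ((Λ.comp_idp a).trans (Λ.idp_comp a).symm) (h.trans (Λ.d_idp _).symm)).1

/-! ### Infinite paths -/

/-- An infinite path in `Λ`: a degree-preserving functor from `Ωₖ` to `Λ`, where `Ωₖ` has object
set `ℕᵏ` and exactly one morphism `(p, q)`, with range `p`, source `q` and degree `q - p`, for each
pair `p ≤ q`. -/
@[ext]
structure InfPath where
  obj : (Fin k → ℕ) → V
  map : (p q : Fin k → ℕ) → p ≤ q → P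
  r_map : ∀ p q h, Λ.r (map p q h) = obj p
  s_map : ∀ p q h, Λ.s (map p q h) = obj q
  d_map : ∀ p q h, Λ.d (map p q h) = q - p
  map_self : ∀ p, map p p le_rfl = Λ.idp (obj p)
  map_comp : ∀ p q m (h : p ≤ q) (h' : q ≤ m),
    Λ.comp (map p q h) (map q m h') ((s_map p q h).trans (r_map q m h').symm)
      = map p m (h.trans h')

variable {Λ}

/-- The shift `σᵐ`, `σᵐ(x)(p, q) = x(p + m, q + m)`. -/
def InfPath.shift (m : Fin k → ℕ) (x : Λ.InfPath) : Λ.InfPath where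
  obj p := x.obj (p + m)
  map p q h := x.map (p + m) (q + m) (add_le_add_left h m)
  r_map _ _ _ := x.r_map _ _ _
  s_map _ _ _ := x.s_map _ _ _
  d_map p q h := by rw [x.d_map, add_tsub_add_eq_tsub_right]
  map_self _ := x.map_self _
  map_comp _ _ _ _ _ := x.map_comp _ _ _ _ _

/-- The infinite path with initial pieces `I q`, `q ∈ ℕᵏ`. -/
def InfPath.ofHeads (I : (Fin k → ℕ) → P) (hd : ∀ q, Λ.d (I q) = q)
    (hI : ∀ p q, p ≤ q → ∃ c, ∃ h : Λ.s (I p) = Λ.r c, Λ.comp (I p) c h = I q) :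
    Λ.InfPath :=
  have key : ∀ p q, p ≤ q → ∃ h : Λ.s (I p) = Λ.r (Λ.tail (I q) p),
      Λ.comp (I p) (Λ.tail (I q) p) h = I q := by
    intro p q hpq
    obtain ⟨c, h, e⟩ := hI p q hpq
    have : Λ.tail (I q) p = c := by
      have := Λ.tail_comp (I p) c h
      rwa [e, hd] at this
    rw [this]; exact ⟨h, e⟩
  { obj := fun p => Λ.s (I p)
    map := fun p q _ => Λ.tail (I q) p
    r_map := fun p q h => (key p q h).1.symm
    s_map := fun p q h => by
      obtain ⟨h1, h2⟩ := key p q h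
      rw [← Λ.s_comp _ _ h1, h2]
    d_map := fun p q h => by
      obtain ⟨h1, h2⟩ := key p q h
      have := congrArg Λ.d h2
      rw [Λ.d_comp, hd, hd] at this
      exact eq_tsub_of_add_eq ((add_comm _ _).trans this)
    map_self := fun p => by
      have := Λ.tail_comp (I p) (Λ.idp (Λ.s (I p))) (Λ.r_idp _).symm
      rwa [Λ.comp_idp, hd] at this
    map_comp := fun p q m h h' => by
      obtain ⟨h1, e1⟩ := key p q h
      obtain ⟨h2, e2⟩ := key q m h'
      obtain ⟨h3, e3⟩ := key p m (h.trans h')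
      have hs : Λ.s (Λ.tail (I q) p) = Λ.r (Λ.tail (I m) q) := by
        rw [← Λ.s_comp _ _ h1, e1]; exact h2
      refine (Λ.comp_inj (h1.trans (Λ.r_comp _ _ hs).symm) h3 ?_ rfl).2
      rw [← Λ.comp_assoc _ _ _ h1 hs, e3]
      exact (Λ.comp_congr e1 rfl _ h2).trans e2 }

/-- The infinite path `λ x`, for a path `λ` and an infinite path `x` with range `s(λ)`: its
initial piece of degree `q` is that of the finite path `λ x(0, q)`. -/
def InfPath.cons (a : P) (x : Λ.InfPath) (hx : x.obj 0 = Λ.s a) : Λ.InfPath :=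
  InfPath.ofHeads
    (fun q => Λ.head (Λ.comp a (x.map 0 q zero_le) ((x.r_map _ _ _).trans hx).symm) q)
    (fun q => (Λ.head_tail _ q (by
      rw [Λ.d_comp, x.d_map, tsub_zero]; exact le_add_self)).2)
    (by
      intro p q hpq
      have hA : ∀ q, Λ.s a = Λ.r (x.map 0 q zero_le) :=
        fun q => ((x.r_map _ _ _).trans hx).symm
      have hle : ∀ q, q ≤ Λ.d (Λ.comp a (x.map 0 q zero_le) (hA q)) := fun q => by
        rw [Λ.d_comp, x.d_map, tsub_zero]; exact le_add_self
      change ∃ c, ∃ h : Λ.s (Λ.head (Λ.comp a (x.map 0 p zero_le) (hA p)) p) = Λ.r c,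
        Λ.comp _ c h = Λ.head (Λ.comp a (x.map 0 q zero_le) (hA q)) q
      have hm := x.map_comp 0 p q zero_le hpq
      obtain ⟨⟨u1, u2⟩, u3⟩ := Λ.head_tail _ p (hle p)
      obtain ⟨⟨w1, w2⟩, w3⟩ := Λ.head_tail _ q (hle q)
      obtain ⟨⟨z1, z2⟩, z3⟩ := Λ.head_tail
        (Λ.head (Λ.comp a (x.map 0 q zero_le) (hA q)) q) p (by rw [w3]; exact hpq)
      generalize hI : Λ.head (Λ.comp a (x.map 0 q zero_le) (hA q)) q = Iq at *
      generalize hT : Λ.tail (Λ.comp a (x.map 0 q zero_le) (hA q)) q = Tq at *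
      generalize hJ : Λ.head (Λ.comp a (x.map 0 p zero_le) (hA p)) p = Ip at *
      generalize hU : Λ.tail (Λ.comp a (x.map 0 p zero_le) (hA p)) p = Tp at *
      have hs : Λ.s (x.map 0 p zero_le) = Λ.r (x.map p q hpq) :=
        (x.s_map _ _ _).trans (x.r_map _ _ _).symm
      have hs2 : Λ.s Tp = Λ.r (x.map p q hpq) := by
        rw [← Λ.s_comp _ _ u1, u2, Λ.s_comp]; exact hs
      have hs3 : Λ.s (Λ.tail Iq p) = Λ.r Tq := by
        rw [← Λ.s_comp _ _ z1, z2]; exact w1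
      have e1 : Λ.comp Ip (Λ.comp Tp (x.map p q hpq) hs2) (u1.trans (Λ.r_comp _ _ hs2).symm)
          = Λ.comp a (x.map 0 q zero_le) (hA q) := by
        rw [← Λ.comp_assoc _ _ _ u1 hs2]
        refine (Λ.comp_congr u2 rfl _ ((Λ.s_comp _ _ _).trans hs)).trans ?_
        rw [Λ.comp_assoc _ _ _ (hA p) hs]
        exact Λ.comp_congr rfl hm _ _
      have e2 : Λ.comp (Λ.head Iq p) (Λ.comp (Λ.tail Iq p) Tq hs3)
          (z1.trans (Λ.r_comp _ _ hs3).symm)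
          = Λ.comp a (x.map 0 q zero_le) (hA q) := by
        rw [← Λ.comp_assoc _ _ _ z1 hs3]
        exact (Λ.comp_congr z2 rfl _ w1).trans w2
      have e3 := (Λ.comp_inj _ _ (e1.trans e2.symm) (u3.trans z3.symm)).1
      rw [e3]
      exact ⟨_, z1, z2⟩)

/-- The initial piece of `λ x` of degree `d(λ)` is `λ`. -/
theorem InfPath.cons_map (a : P) (x : Λ.InfPath) (hx : x.obj 0 = Λ.s a) :
    (x.cons a hx).map 0 (Λ.d a) zero_le = a := by
  have h0 : ∀ b c : P, (∃ h : Λ.s b = Λ.r c, Λ.comp b c h = a) → Λ.d b = 0 → c = a := by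
    rintro b c ⟨h, e⟩ hb
    exact (Λ.comp_inj h (Λ.s_idp _) (e.trans (Λ.idp_comp a).symm) (hb.trans (Λ.d_idp _).symm)).2
  have h1 : Λ.head (Λ.comp a (x.map 0 (Λ.d a) zero_le) ((x.r_map _ _ _).trans hx).symm) (Λ.d a)
      = a := Λ.head_comp _ _ _
  change Λ.tail (Λ.head (Λ.comp a (x.map 0 (Λ.d a) zero_le) _) (Λ.d a)) 0 = a
  rw [h1]
  obtain ⟨h2, h3⟩ := Λ.head_tail a 0 zero_le
  exact h0 _ _ h2 h3

/-- Shifting `λ x` by `d(λ)` gives back `x`. -/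
theorem InfPath.shift_cons (a : P) (x : Λ.InfPath) (hx : x.obj 0 = Λ.s a) :
    (x.cons a hx).shift (Λ.d a) = x := by
  have hA : ∀ q, Λ.s a = Λ.r (x.map 0 q zero_le) := fun q => ((x.r_map _ _ _).trans hx).symm
  have hH : ∀ q, Λ.head (Λ.comp a (x.map 0 (q + Λ.d a) zero_le) (hA _)) (q + Λ.d a)
      = Λ.comp a (x.map 0 q zero_le) (hA q) := by
    intro q
    have hqq : q ≤ q + Λ.d a := le_self_add
    have hs : Λ.s (x.map 0 q zero_le) = Λ.r (x.map q (q + Λ.d a) hqq) :=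
        (x.s_map _ _ _).trans (x.r_map _ _ _).symm
    have e : Λ.comp (Λ.comp a (x.map 0 q zero_le) (hA q)) (x.map q (q + Λ.d a) hqq)
      ((Λ.s_comp _ _ _).trans hs) = Λ.comp a (x.map 0 (q + Λ.d a) zero_le) (hA _) := by
      rw [Λ.comp_assoc _ _ _ (hA q) hs]
      exact Λ.comp_congr rfl (x.map_comp 0 q _ zero_le hqq) _ _
    have := Λ.head_comp (Λ.comp a (x.map 0 q zero_le) (hA q)) (x.map q (q + Λ.d a) hqq) ((Λ.s_comp _ _ _).trans hs)
    rw [e, Λ.d_comp, x.d_map, tsub_zero, add_comm (Λ.d a) q] at this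
    exact this
  have hm : ∀ p q h, ((x.cons a hx).shift (Λ.d a)).map p q h = x.map p q h := by
    intro p q h
    change Λ.tail (Λ.head (Λ.comp a (x.map 0 (q + Λ.d a) zero_le) _) (q + Λ.d a)) (p + Λ.d a) = _
    rw [hH]
    have hs : Λ.s (x.map 0 p zero_le) = Λ.r (x.map p q h) :=
        (x.s_map _ _ _).trans (x.r_map _ _ _).symm
    have e : Λ.comp (Λ.comp a (x.map 0 p zero_le) (hA p)) (x.map p q h)
      ((Λ.s_comp _ _ _).trans hs) = Λ.comp a (x.map 0 q zero_le) (hA _) := by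
      rw [Λ.comp_assoc _ _ _ (hA p) hs]
      exact Λ.comp_congr rfl (x.map_comp 0 p _ zero_le h) _ _
    have := Λ.tail_comp (Λ.comp a (x.map 0 p zero_le) (hA p)) (x.map p q h) ((Λ.s_comp _ _ _).trans hs)
    rw [e, Λ.d_comp, x.d_map, tsub_zero, add_comm] at this
    exact this
  ext p q h
  · rw [← InfPath.r_map _ p p le_rfl, hm, x.r_map]
  · exact hm p q h

variable (Λ)

/-- The cylinder set `Z(λ)` of all infinite paths with initial piece `λ`. -/
def cylinder (a : P) : Set Λ.InfPath := {x | x.map 0 (Λ.d a) zero_le = a}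

/-- The topology of `Λ^∞`, generated by the cylinder sets. -/
instance : TopologicalSpace Λ.InfPath := .generateFrom (range Λ.cylinder)

/-- `Λ^∞` carries its Borel σ-algebra. -/
instance : MeasurableSpace Λ.InfPath := borel _

instance : BorelSpace Λ.InfPath := ⟨rfl⟩

variable {Λ}

theorem InfPath.obj_zero_of_mem {v : V} {x : Λ.InfPath} (hx : x ∈ Λ.cylinder (Λ.idp v)) :
    x.obj 0 = v := by
  have h : x.map 0 (Λ.d (Λ.idp v)) zero_le = Λ.idp v := hx
  rw [← x.r_map 0 _ zero_le, h, Λ.r_idp]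

variable (Λ)

/-- The standard prefixing map `σ_λ : Z(s(λ)) → Λ^∞`, `σ_λ(x) = λ x`. -/
def stdPrefix (a : P) (x : Λ.cylinder (Λ.idp (Λ.s a))) : Λ.InfPath :=
  InfPath.cons a x.1 (InfPath.obj_zero_of_mem x.2)

/-! ### The Perron-Frobenius measure -/

/-- The `i`-th vertex matrix `A_i(v, w) = |v Λ^{e_i} w|` (of a finite `k`-graph). -/
def vertexMatrix (i : Fin k) : Matrix V V ℕ :=
  fun v w => Nat.card {a : P // Λ.d a = Pi.single i 1 ∧ Λ.r a = v ∧ Λ.s a = w}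

/-- `ρ_i`, the spectral radius of the `i`-th vertex matrix. -/
def rho [Fintype V] [DecidableEq V] (i : Fin k) : ℝ :=
  (spectralRadius ℂ ((Λ.vertexMatrix i).map (Nat.cast : ℕ → ℂ))).toReal

/-- `κ` is the unimodular Perron-Frobenius eigenvector of `Λ`. -/
def IsPerronFrobeniusVector [Fintype V] [DecidableEq V] (κ : V → ℝ) : Prop :=
  (∀ v, 0 < κ v) ∧ ∑ v, κ v = 1 ∧
    ∀ i, ((Λ.vertexMatrix i).map (Nat.cast : ℕ → ℝ)).mulVec κ = Λ.rho i • κ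

/-- `M` is the Perron-Frobenius measure on `Λ^∞`: `M(Z(λ)) = ρ(Λ)^{-d(λ)} κ_{s(λ)}` for all
paths `λ`. -/
def IsPerronFrobeniusMeasure [Fintype V] [DecidableEq V] (M : Measure Λ.InfPath) : Prop :=
  ∃ κ : V → ℝ, Λ.IsPerronFrobeniusVector κ ∧
    ∀ a, M (Λ.cylinder a) = ENNReal.ofReal ((∏ i, (Λ.rho i)⁻¹ ^ Λ.d a i) * κ (Λ.s a))

end KGraph

/-! ### Semibranching function systems -/

section Semibranching

variable {X : Type*} [MeasurableSpace X]

/-- The measure `μ ∘ τ` on `X`, `E ↦ μ (τ (E ∩ D))`, for an injective map `τ : D → X` that sends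
measurable sets to measurable sets. -/
def compMeasure (μ : Measure X) (D : Set X) (τ : D → X) : Measure X :=
  (μ.comap τ).map Subtype.val

/-- The Radon-Nikodym derivative `Φ_τ = d(μ ∘ τ)/dμ`. -/
def prefixDeriv (μ : Measure X) (D : Set X) (τ : D → X) : X → ℝ≥0∞ :=
  (compMeasure μ D τ).rnDeriv μ

/-- The family of maps `τ i : D i → X` is a semibranching function system on `(X, μ)`.
The conditions `injective` and `measurableSet_image` say that `μ ∘ τ i` makes sense as a measure,
and `hasDeriv` that it has a Radon-Nikodym derivative. -/
structure IsSemibranching {ι : Type*} (μ : Measure X) (D : ι → Set X) (τ : ∀ i, D i → X) :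
    Prop where
  measurableSet_dom : ∀ i, MeasurableSet (D i)
  measurable : ∀ i, Measurable (τ i)
  injective : ∀ i, Function.Injective (τ i)
  measurableSet_image : ∀ i (E : Set (D i)), MeasurableSet E → MeasurableSet (τ i '' E)
  cover : μ (⋃ i, range (τ i))ᶜ = 0
  disjoint : ∀ i j, i ≠ j → μ (range (τ i) ∩ range (τ j)) = 0
  hasDeriv : ∀ i, compMeasure μ (D i) (τ i) = μ.withDensity (prefixDeriv μ (D i) (τ i))
  deriv_pos : ∀ i, ∀ᵐ x ∂μ, x ∈ D i →
    0 < prefixDeriv μ (D i) (τ i) x ∧ prefixDeriv μ (D i) (τ i) x < ∞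

/-- `T` is a coding map for the family `τ i : D i → X`. -/
def IsCodingMap {ι : Type*} (D : ι → Set X) (τ : ∀ i, D i → X) (T : X → X) : Prop :=
  Measurable T ∧ ∀ i (x : D i), T (τ i x) = x

variable {k : ℕ} {V P : Type*}

/-- The sets `D a`, prefixing maps `τ a : D a → X` (for the paths `a` of `Λ`) and coding maps `T m`
(for `m ∈ ℕᵏ`) form a `Λ`-semibranching function system on `(X, μ)`. -/
structure IsLambdaSemibranching (Λ : KGraph k V P) (μ : Measure X) (D : P → Set X)
    (τ : ∀ a, D a → X) (T : (Fin k → ℕ) → X → X) : Prop where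
  semibranching : ∀ m : Fin k → ℕ,
    IsSemibranching μ (fun a : {a : P // Λ.d a = m} => D a) (fun a => τ a)
  coding : ∀ m : Fin k → ℕ,
    IsCodingMap (fun a : {a : P // Λ.d a = m} => D a) (fun a => τ a) (T m)
  vertex_id : ∀ v (x : D (Λ.idp v)), τ (Λ.idp v) x = x
  vertex_pos : ∀ v, 0 < μ (D (Λ.idp v))
  range_subset : ∀ a b, Λ.s a = Λ.r b → μ (range (τ b) \ D a) = 0
  dom_comp : ∀ a b (h : Λ.s a = Λ.r b), D (Λ.comp a b h) =ᵐ[μ] D b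
  prefix_comp : ∀ a b (h : Λ.s a = Λ.r b), ∀ᵐ x ∂μ, ∀ hx : x ∈ D b,
    ∃ (h₁ : τ b ⟨x, hx⟩ ∈ D a) (h₂ : x ∈ D (Λ.comp a b h)),
      τ a ⟨τ b ⟨x, hx⟩, h₁⟩ = τ (Λ.comp a b h) ⟨x, h₂⟩
  coding_add : ∀ m n, T m ∘ T n = T (m + n)

end Semibranching

/-! ### The C*-algebra of a higher-rank graph -/

namespace KGraph

variable {k : ℕ} {V : Type*} {P : Type*} (Λ : KGraph k V P)

/-- Cuntz-Krieger `Λ`-families in a C*-algebra, for a row-finite `k`-graph `Λ` with no sources. -/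
structure IsCuntzKrieger {B : Type*} [NonUnitalCStarAlgebra B] (t : P → B) : Prop where
  partial_isometry : ∀ a, t a * star (t a) * t a = t a
  ck1_proj : ∀ v, IsStarProjection (t (Λ.idp v))
  ck1_orth : ∀ v w, v ≠ w → t (Λ.idp v) * t (Λ.idp w) = 0
  ck2 : ∀ a b (h : Λ.s a = Λ.r b), t a * t b = t (Λ.comp a b h)
  ck3 : ∀ a, star (t a) * t a = t (Λ.idp (Λ.s a))
  /-- Here `F` is the (finite) set `v Λⁿ`. -/
  ck4 : ∀ (v : V) (n : Fin k → ℕ) (F : Finset P), (∀ a, a ∈ F ↔ Λ.r a = v ∧ Λ.d a = n) →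
    t (Λ.idp v) = ∑ a ∈ F, t a * star (t a)

end KGraph

universe u v

/-- A Cuntz-Krieger `Λ`-family together with the C*-algebra in which it lives. -/
structure CKFamily {k : ℕ} {V : Type v} {P : Type u} (Λ : KGraph k V P) : Type (max (u + 1) v) where
  alg : Type u
  [cstar : NonUnitalCStarAlgebra alg]
  t : P → alg
  isCK : Λ.IsCuntzKrieger t

attribute [instance] CKFamily.cstar

namespace KGraph

variable {k : ℕ} {V : Type v} {P : Type u} (Λ : KGraph k V P)

theorem IsCuntzKrieger.norm_le_one {Λ : KGraph k V P} {B : Type*} [NonUnitalCStarAlgebra B]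
    {t : P → B} (ht : Λ.IsCuntzKrieger t) (a : P) : ‖t a‖ ≤ 1 := by
  have h1 : ‖star (t a) * t a‖ ≤ 1 := by
    rw [ht.ck3]
    have hp := ht.ck1_proj (Λ.s a)
    have : ‖t (Λ.idp (Λ.s a))‖ * ‖t (Λ.idp (Λ.s a))‖ = ‖t (Λ.idp (Λ.s a))‖ := by
      rw [← CStarRing.norm_star_mul_self, hp.isSelfAdjoint.star_eq, hp.isIdempotentElem.eq]
    nlinarith [norm_nonneg (t (Λ.idp (Λ.s a)))]
  rw [CStarRing.norm_star_mul_self] at h1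
  nlinarith [norm_nonneg (t a)]

/-- The family `λ ↦ (t_λ)_t` in the `ℓ^∞`-product over all Cuntz-Krieger families `t`. -/
def productFamily (a : P) : lp (fun F : CKFamily Λ => F.alg) ∞ :=
  ⟨fun F => F.t a, memℓp_infty ⟨1, by rintro _ ⟨F, rfl⟩; exact F.isCK.norm_le_one a⟩⟩

/-- `C*(Λ)`, the universal C*-algebra generated by a Cuntz-Krieger `Λ`-family, realised as the
C*-algebra generated by the product of all Cuntz-Krieger families. -/
def cstar : NonUnitalStarSubalgebra ℂ (lp (fun F : CKFamily Λ => F.alg) ∞) :=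
  (NonUnitalStarAlgebra.adjoin ℂ (range Λ.productFamily)).topologicalClosure

instance : IsClosed (Λ.cstar : Set (lp (fun F : CKFamily Λ => F.alg) ∞)) :=
  NonUnitalStarSubalgebra.isClosed_topologicalClosure _

/-- The canonical generators `t_λ` of `C*(Λ)`. -/
def gen (a : P) : Λ.cstar :=
  ⟨Λ.productFamily a, NonUnitalStarSubalgebra.le_topologicalClosure _
    (NonUnitalStarAlgebra.subset_adjoin ℂ _ ⟨a, rfl⟩)⟩

/-- The coordinate projections of the product. -/
def evalFamily (F : CKFamily Λ) : lp (fun F : CKFamily Λ => F.alg) ∞ →⋆ₙₐ[ℂ] F.alg where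
  toFun c := c F
  map_smul' _ _ := rfl
  map_zero' := rfl
  map_add' _ _ := rfl
  map_mul' _ _ := rfl
  map_star' _ := rfl

/-- The generators of `C*(Λ)` form a Cuntz-Krieger family. -/
theorem isCuntzKrieger_gen : Λ.IsCuntzKrieger Λ.gen where
  partial_isometry a := Subtype.ext <| lp.ext <| funext fun F => F.isCK.partial_isometry a
  ck1_proj v := ⟨Subtype.ext <| lp.ext <| funext fun F => (F.isCK.ck1_proj v).isIdempotentElem,
    Subtype.ext <| lp.ext <| funext fun F => (F.isCK.ck1_proj v).isSelfAdjoint⟩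
  ck1_orth v w h := Subtype.ext <| lp.ext <| funext fun F => F.isCK.ck1_orth v w h
  ck2 a b h := Subtype.ext <| lp.ext <| funext fun F => F.isCK.ck2 a b h
  ck3 a := Subtype.ext <| lp.ext <| funext fun F => F.isCK.ck3 a
  ck4 v n S hS := Subtype.ext <| lp.ext <| funext fun F => by
    have h := F.isCK.ck4 v n S hS
    have e := map_sum ((Λ.evalFamily F).comp (NonUnitalStarSubalgebraClass.subtype Λ.cstar))
      (fun a => Λ.gen a * star (Λ.gen a)) S
    exact h.trans e.symm

/-- The universal property of `C*(Λ)`. -/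
theorem existsUnique_lift {B : Type u} [NonUnitalCStarAlgebra B] {t : P → B}
    (ht : Λ.IsCuntzKrieger t) : ∃! π : Λ.cstar →⋆ₙₐ[ℂ] B, ∀ a, π (Λ.gen a) = t a := by
  refine ⟨(Λ.evalFamily ⟨B, t, ht⟩).comp (NonUnitalStarSubalgebraClass.subtype Λ.cstar),
    fun a => rfl, fun π hπ => ?_⟩
  set π' := (Λ.evalFamily ⟨B, t, ht⟩).comp (NonUnitalStarSubalgebraClass.subtype Λ.cstar)
  have h1 : ∀ x (_ : x ∈ NonUnitalStarAlgebra.adjoin ℂ (range Λ.productFamily))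
      (h : x ∈ Λ.cstar), π ⟨x, h⟩ = π' ⟨x, h⟩ := by
    have hle := NonUnitalStarSubalgebra.le_topologicalClosure
      (NonUnitalStarAlgebra.adjoin ℂ (range Λ.productFamily))
    intro x hx
    induction hx using NonUnitalStarAlgebra.adjoin_induction with
    | mem x hx => obtain ⟨a, rfl⟩ := hx; exact fun _ => hπ a
    | add x y hx hy ihx ihy =>
      intro _
      have := congrArg₂ (· + ·) (ihx (hle hx)) (ihy (hle hy))
      simp only [← map_add] at this
      exact this
    | zero => exact fun _ => (map_zero π).trans (map_zero π').symm
    | mul x y hx hy ihx ihy =>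
      intro _
      have := congrArg₂ (· * ·) (ihx (hle hx)) (ihy (hle hy))
      simp only [← map_mul] at this
      exact this
    | smul r x hx ih =>
      intro _
      have := congrArg (r • ·) (ih (hle hx))
      simp only [← map_smul] at this
      exact this
    | star x hx ih =>
      intro _
      have := congrArg star (ih (hle hx))
      simp only [← map_star] at this
      exact this
  ext c
  obtain ⟨y, hy, hlim⟩ := mem_closure_iff_seq_limit.1 (show c.1 ∈ closure _ from c.2)
  have hy' : ∀ n, y n ∈ Λ.cstar := fun n => subset_closure (hy n)
  have hl : Filter.Tendsto (fun n => (⟨y n, hy' n⟩ : Λ.cstar)) Filter.atTop (nhds c) :=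
    tendsto_subtype_rng.2 hlim
  have hc : ∀ φ : Λ.cstar →⋆ₙₐ[ℂ] B, Continuous φ := fun φ =>
    AddMonoidHomClass.continuous_of_bound φ 1 fun z => by
      rw [one_mul]; exact NonUnitalStarAlgHom.norm_apply_le φ z
  have c1 := ((hc π).tendsto c).comp hl
  have c2 := ((hc π').tendsto c).comp hl
  refine tendsto_nhds_unique c1 (c2.congr fun n => (h1 _ (hy n) _).symm)

end KGraph

/-! ### Semibranching representations -/

section Representation

variable {k : ℕ} {V : Type v} {P : Type u} {X : Type*} [MeasurableSpace X]

/-- `π` is the representation of `C*(Λ)` on `L²(X, μ)` associated to a `Λ`-semibranching function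
system: `S_λ = π(t_λ)` is given by
`S_λ ξ (x) = χ_{R_λ}(x) Φ_{τ_λ}(τ^{d(λ)}(x))^{-1/2} ξ(τ^{d(λ)}(x))`. -/
def IsSemibranchingRep (Λ : KGraph k V P) (μ : Measure X) (D : P → Set X)
    (τ : ∀ a, D a → X) (T : (Fin k → ℕ) → X → X)
    (π : Λ.cstar →⋆ₙₐ[ℂ] (Lp ℂ 2 μ →L[ℂ] Lp ℂ 2 μ)) : Prop :=
  ∀ (a : P) (ξ : Lp ℂ 2 μ), π (Λ.gen a) ξ =ᵐ[μ] (range (τ a)).indicator fun x =>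
    ((prefixDeriv μ (D a) (τ a) (T (Λ.d a) x)).toReal ^ (-(1 / 2 : ℝ)) : ℝ) • ξ (T (Λ.d a) x)

/-- Unitary equivalence of two representations of `C*(Λ)`. -/
def UnitarilyEquivalent {Λ : KGraph k V P} {H K : Type*}
    [NormedAddCommGroup H] [InnerProductSpace ℂ H] [CompleteSpace H]
    [NormedAddCommGroup K] [InnerProductSpace ℂ K] [CompleteSpace K]
    (π : Λ.cstar →⋆ₙₐ[ℂ] (H →L[ℂ] H)) (ρ : Λ.cstar →⋆ₙₐ[ℂ] (K →L[ℂ] K)) : Prop :=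
  ∃ U : H ≃ₗᵢ[ℂ] K, ∀ c ξ, U (π c ξ) = ρ c (U ξ)

end Representation

namespace KGraph

variable {k : ℕ} {V : Type v} {P : Type u} (Λ : KGraph k V P)

/-- The standard prefixing and coding maps make `(Λ^∞, μ)` a `Λ`-semibranching function system. -/
def StandardSemibranching (μ : Measure Λ.InfPath) : Prop :=
  IsLambdaSemibranching Λ μ (fun a => Λ.cylinder (Λ.idp (Λ.s a))) Λ.stdPrefix InfPath.shift

/-- `π` is the `Λ`-semibranching representation of `C*(Λ)` on `L²(Λ^∞, μ)` that is associated to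
the standard prefixing and coding maps. -/
def IsStandardRep (μ : Measure Λ.InfPath)
    (π : Λ.cstar →⋆ₙₐ[ℂ] (Lp ℂ 2 μ →L[ℂ] Lp ℂ 2 μ)) : Prop :=
  IsSemibranchingRep Λ μ (fun a => Λ.cylinder (Λ.idp (Λ.s a))) Λ.stdPrefix InfPath.shift π

end KGraph

/-! ### The 2-graphs `Λ_{2N}` and the product measures -/

/-- The vertices `v, u_1, …, u_N, w_1, …, w_N`. -/
inductive StarVertex (N : ℕ) : Type
  | v : StarVertex N
  | u : Fin N → StarVertex N
  | w : Fin N → StarVertex N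
  deriving DecidableEq, Fintype

/-- `Λ` is a 2-graph `Λ_{2N}` (for some choice of factorization rules): in each of the two colours
there is exactly one edge from `v` to each `u_i` and each `w_i`, exactly one edge back, and no
other edge. -/
def IsLambda2N {N : ℕ} {P : Type u} (Λ : KGraph 2 (StarVertex N) P) : Prop :=
  ∀ (i : Fin 2) (a b : StarVertex N),
    (Xor (a = .v) (b = .v) → ∃! e : P, Λ.d e = Pi.single i 1 ∧ Λ.r e = a ∧ Λ.s e = b) ∧
    ((∃ e : P, Λ.d e = Pi.single i 1 ∧ Λ.r e = a ∧ Λ.s e = b) → Xor (a = .v) (b = .v))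

/-- The position reached after `l` edges of an alternating red-blue string of edges that starts
with a red edge; blue is the colour `0` and red is the colour `1`. -/
def altPos (l : ℕ) : Fin 2 → ℕ := ![l / 2, (l + 1) / 2]

/-- `α_i = δ^j_i` if `Q_i = u_j` and `α_i = -δ^j_i` if `Q_i = w_j` (and, immaterially, `0` at
the vertex `v`). -/
def alphaAt {N : ℕ} (δ : Fin N → ℕ → ℝ) (i : ℕ) : StarVertex N → ℝ
  | .v => 0
  | .u j => δ j i
  | .w j => -δ j i

/-- The number assigned to `Z(η)`, where `d(η) = (n, n)` and `η` passes through the vertices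
`Q_0, Q_1, …, Q_{2n}`. -/
def productWeight {N : ℕ} {P : Type u} (Λ : KGraph 2 (StarVertex N) P) (δ : Fin N → ℕ → ℝ)
    (n : ℕ) (η : P) : ℝ :=
  if Λ.r η = .v then
    ∏ i ∈ Finset.Icc 1 n,
      (1 + alphaAt δ (2 * i - 1) (Λ.vertexAt η (altPos (2 * i - 1)))) / (2 * N)
  else
    ∏ i ∈ Finset.Icc 0 n, (1 + alphaAt δ (2 * i) (Λ.vertexAt η (altPos (2 * i)))) / (2 * N)

/-- `μ` is the product measure `μ_{2N}` associated to the sequences `δ`. -/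
def IsProductMeasure {N : ℕ} {P : Type u} (Λ : KGraph 2 (StarVertex N) P) (δ : Fin N → ℕ → ℝ)
    (μ : Measure Λ.InfPath) : Prop :=
  ∀ (n : ℕ) (η : P), Λ.d η = (fun _ => n) →
    μ (Λ.cylinder η) = ENNReal.ofReal (productWeight Λ δ n η)

end

noncomputable section

universe u

namespace KGraph

variable {k : ℕ} {V P : Type*} {Λ : KGraph k V P}

/-! ### Initial pieces and shifts of infinite paths -/

/-! Reading an infinite path along the staircase red, blue, red, ... yields its vertex sequence, a
walk on the star with centre `v` and `2N` leaves. Adjacent vertices are joined by exactly one edge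
of each colour in each direction, so the walk determines the path and every walk occurs
(`eq_of_vertexAt`, `exists_infPath`), whatever the factorization rules. A cylinder of degree `(n,
n)` becomes a prescription of the first `2n + 1` vertices (`mem_cylinder_iff_vertices`). These
cylinders form a π-system that generates the Borel sets, so they determine both measures
(`measure_ext`).

A walk is at `v` at all even times or at all odd times, and the leaves visited in between are free.
Hence `μ_{2N}` is the sum of the images of two infinite product measures, one for each parity, in
which the leaf at time `l` has probability `(1 + α_l) / (2N)`. Taking `δ = 0` and weighting the two
parts by `κ_v` and by the total of `κ` over the leaves gives `M`, with `ρ_1 = ρ_2 = √(2N)`. The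
formula for `M` passes from diagonal degrees to all degrees by summing over a last edge, which is
the eigenvector equation for `κ`.

For the equivalence, the one-step probabilities with and without `δ` bound each other up to the
factor `K_l = ∏_j (1 - |δ^j_l|)⁻¹`, and the partial products of the `K_l` are bounded because `δ` is
summable. The product measures are therefore comparable, with one constant, on all cylinders, hence
on open sets, and outer regularity transfers null sets in both directions
(`infinitePi_absolutelyContinuous`).

The rest uses only that `σ_λ` multiplies `M` by a constant `c_λ = ρ_1^{-d(λ)_1} ρ_2^{-d(λ)_2}`
(`IsScaling`) and that `μ = h M` with `0 < h < ∞`. A change of variables gives the derivative `c_λ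
h(λy) / h(y)` of `μ ∘ σ_λ`, whence the semibranching system. On `L²(M)` the operators `ξ ↦
c_λ^{-1/2} χ_{Z(λ)} (ξ ∘ σ^{d(λ)})` form a Cuntz–Krieger family and so define a representation. The
unitary `ξ ↦ √h ξ` from `L²(μ)` to `L²(M)` matches the two formulas on generators, so being standard
means being intertwined by `√h` with this one representation (`isStandardRep_iff`). Existence,
uniqueness and unitary equivalence follow together; `M` itself is the case `h = 1`. -/

theorem tail_zero (a : P) : Λ.tail a 0 = a := by
  obtain ⟨⟨h, e⟩, hd⟩ := Λ.head_tail a 0 zero_le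
  exact (Λ.comp_inj h (Λ.s_idp _) (e.trans (Λ.idp_comp a).symm) (hd.trans (Λ.d_idp _).symm)).2

theorem r_head {a : P} {p : Fin k → ℕ} (hp : p ≤ Λ.d a) : Λ.r (Λ.head a p) = Λ.r a := by
  obtain ⟨⟨h, e⟩, -⟩ := Λ.head_tail a p hp
  rw [← Λ.r_comp _ _ h, e]

theorem head_eq_of_comp {a b c : P} {p : Fin k → ℕ} (h : Λ.s a = Λ.r b)
    (e : Λ.comp a b h = c) (hp : Λ.d a = p) : Λ.head c p = a := by
  subst e hp; exact Λ.head_comp a b h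

theorem tail_eq_of_comp {a b c : P} {p : Fin k → ℕ} (h : Λ.s a = Λ.r b)
    (e : Λ.comp a b h = c) (hp : Λ.d a = p) : Λ.tail c p = b := by
  subst e hp; exact Λ.tail_comp a b h

theorem head_head {a : P} {p q : Fin k → ℕ} (hpq : p ≤ q) (hq : q ≤ Λ.d a) :
    Λ.head (Λ.head a q) p = Λ.head a p := by
  obtain ⟨⟨h, e⟩, hd⟩ := Λ.head_tail a q hq
  obtain ⟨⟨h', e'⟩, hd'⟩ := Λ.head_tail (Λ.head a q) p (hpq.trans hd.ge)
  have h'' : Λ.s (Λ.tail (Λ.head a q) p) = Λ.r (Λ.tail a q) := by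
    rw [← Λ.s_comp _ _ h', e', h]
  refine (Λ.head_eq_of_comp (b := Λ.comp _ _ h'') (h'.trans (Λ.r_comp _ _ _).symm) ?_ hd').symm
  rw [← Λ.comp_assoc _ _ _ h' h'', Λ.comp_congr e' rfl _ h, e]

theorem head_d (a : P) : Λ.head a (Λ.d a) = a :=
  Λ.head_eq_of_comp (Λ.r_idp _).symm (Λ.comp_idp a) rfl

namespace InfPath

theorem map_congr (x : Λ.InfPath) {p q p' q' : Fin k → ℕ} (hp : p = p') (hq : q = q')
    (h : p ≤ q) (h' : p' ≤ q') : x.map p q h = x.map p' q' h' := by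
  subst hp hq; rfl

theorem comp_map (x : Λ.InfPath) {p q : Fin k → ℕ} (h : p ≤ q) :
    Λ.comp (x.map 0 p zero_le) (x.map p q h) ((x.s_map _ _ _).trans (x.r_map _ _ _).symm)
      = x.map 0 q zero_le := x.map_comp 0 p q zero_le h

theorem d_map_zero (x : Λ.InfPath) (p : Fin k → ℕ) : Λ.d (x.map 0 p zero_le) = p := by
  rw [x.d_map, tsub_zero]

theorem head_map (x : Λ.InfPath) {p q : Fin k → ℕ} (h : p ≤ q) :
    Λ.head (x.map 0 q zero_le) p = x.map 0 p zero_le :=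
  Λ.head_eq_of_comp _ (x.comp_map h) (x.d_map_zero p)

theorem tail_map (x : Λ.InfPath) {p q : Fin k → ℕ} (h : p ≤ q) :
    Λ.tail (x.map 0 q zero_le) p = x.map p q h :=
  Λ.tail_eq_of_comp _ (x.comp_map h) (x.d_map_zero p)

theorem vertexAt_map (x : Λ.InfPath) {p q : Fin k → ℕ} (h : p ≤ q) :
    Λ.vertexAt (x.map 0 q zero_le) p = x.obj p := by
  rw [vertexAt, x.head_map h, x.s_map]

theorem ext_map_zero {x y : Λ.InfPath} (h : ∀ p, x.map 0 p zero_le = y.map 0 p zero_le) :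
    x = y := by
  have hm : ∀ p q hpq, x.map p q hpq = y.map p q hpq := fun p q hpq => by
    rw [← x.tail_map, ← y.tail_map, h]
  ext p q hpq
  · rw [← x.r_map p p le_rfl, hm, y.r_map]
  · exact hm p q hpq

theorem shift_map_zero (x : Λ.InfPath) (m q : Fin k → ℕ) :
    (x.shift m).map 0 q zero_le = x.map m (q + m) le_add_self :=
  x.map_congr (zero_add m) rfl _ _

theorem shift_obj_zero (x : Λ.InfPath) (m : Fin k → ℕ) : (x.shift m).obj 0 = x.obj m :=
  congrArg x.obj (zero_add m)

theorem shift_shift (x : Λ.InfPath) (m n : Fin k → ℕ) :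
    (x.shift n).shift m = x.shift (m + n) := by
  ext p q h
  · exact congrArg x.obj (add_assoc p m n)
  · exact x.map_congr (add_assoc _ _ _) (add_assoc _ _ _) _ _

theorem eq_of_shift_eq {x y : Λ.InfPath} (m : Fin k → ℕ)
    (h : x.map 0 m zero_le = y.map 0 m zero_le) (hs : x.shift m = y.shift m) : x = y := by
  refine ext_map_zero fun q => ?_
  have e : x.map 0 (q + m) zero_le = y.map 0 (q + m) zero_le := by
    rw [← x.comp_map (p := m) le_add_self, ← y.comp_map (p := m) le_add_self]
    refine Λ.comp_congr h ?_ _ _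
    rw [← x.shift_map_zero, ← y.shift_map_zero, hs]
  rw [← x.head_map (q := q + m) le_self_add, ← y.head_map (q := q + m) le_self_add, e]

theorem cons_map_zero (a : P) (x : Λ.InfPath) (hx : x.obj 0 = Λ.s a) (q : Fin k → ℕ) :
    (x.cons a hx).map 0 q zero_le
      = Λ.head (Λ.comp a (x.map 0 q zero_le) ((x.r_map _ _ _).trans hx).symm) q :=
  Λ.tail_zero _

end InfPath

/-! ### Cylinder sets -/

theorem mem_cylinder_iff {a : P} {m : Fin k → ℕ} (h : Λ.d a = m) {x : Λ.InfPath} :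
    x ∈ Λ.cylinder a ↔ x.map 0 m zero_le = a := by
  subst h; rfl

theorem mem_cylinder_idp {w : V} {x : Λ.InfPath} : x ∈ Λ.cylinder (Λ.idp w) ↔ x.obj 0 = w := by
  refine ⟨InfPath.obj_zero_of_mem, ?_⟩
  rintro rfl
  rw [mem_cylinder_iff (Λ.d_idp _), x.map_self]

theorem InfPath.mem_cylinder_map (x : Λ.InfPath) (q : Fin k → ℕ) :
    x ∈ Λ.cylinder (x.map 0 q zero_le) :=
  (mem_cylinder_iff (x.d_map_zero q)).2 rfl

theorem obj_zero_of_mem_cylinder {a : P} {x : Λ.InfPath} (hx : x ∈ Λ.cylinder a) :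
    x.obj 0 = Λ.r a := by
  rw [← x.r_map 0 (Λ.d a) zero_le, show x.map 0 (Λ.d a) zero_le = a from hx]

theorem obj_d_of_mem_cylinder {a : P} {x : Λ.InfPath} (hx : x ∈ Λ.cylinder a) :
    x.obj (Λ.d a) = Λ.s a := by
  rw [← x.s_map 0 (Λ.d a) zero_le, show x.map 0 (Λ.d a) zero_le = a from hx]

/-- Unique factorization of the initial piece of degree `d(a) + d(b)`. -/
theorem mem_cylinder_comp {a b : P} (h : Λ.s a = Λ.r b) {x : Λ.InfPath} :
    x ∈ Λ.cylinder (Λ.comp a b h) ↔ x ∈ Λ.cylinder a ∧ x.shift (Λ.d a) ∈ Λ.cylinder b := by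
  have hd : Λ.d (Λ.comp a b h) = Λ.d b + Λ.d a := by rw [Λ.d_comp, add_comm]
  rw [mem_cylinder_iff hd, mem_cylinder_iff rfl, mem_cylinder_iff rfl, x.shift_map_zero,
    ← x.comp_map (p := Λ.d a) le_add_self]
  constructor
  · intro e
    exact Λ.comp_inj _ _ e (x.d_map_zero _)
  · rintro ⟨e1, e2⟩
    exact Λ.comp_congr e1 e2 _ _

theorem shift_mem_of_mem_cylinder {a : P} {x : Λ.InfPath} (hx : x ∈ Λ.cylinder a) :
    x.shift (Λ.d a) ∈ Λ.cylinder (Λ.idp (Λ.s a)) := by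
  rw [mem_cylinder_idp, x.shift_obj_zero, obj_d_of_mem_cylinder hx]

theorem disjoint_cylinder {a b : P} (hd : Λ.d a = Λ.d b) (hab : a ≠ b) :
    Disjoint (Λ.cylinder a) (Λ.cylinder b) := by
  refine Set.disjoint_left.2 fun x ha hb => hab ?_
  exact ((mem_cylinder_iff hd).1 ha).symm.trans ((mem_cylinder_iff rfl).1 hb)

theorem iUnion_cylinder (Λ : KGraph k V P) (m : Fin k → ℕ) :
    ⋃ a : {a : P // Λ.d a = m}, Λ.cylinder a = univ :=
  eq_univ_of_forall fun x => mem_iUnion.2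
    ⟨⟨x.map 0 m zero_le, x.d_map_zero m⟩, x.mem_cylinder_map m⟩

theorem isOpen_cylinder (a : P) : IsOpen (Λ.cylinder a) :=
  TopologicalSpace.isOpen_generateFrom_of_mem ⟨a, rfl⟩

theorem measurableSet_cylinder (a : P) : MeasurableSet (Λ.cylinder a) :=
  (isOpen_cylinder a).measurableSet

/-- There are countably many paths, so the cylinders are a countable subbasis; in a second countable
topology a subbasis already generates the Borel sets. -/
theorem borel_eq_generateFrom (Λ : KGraph k V P) :
    (inferInstance : MeasurableSpace Λ.InfPath) = .generateFrom (range Λ.cylinder) := by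
  have := Λ.countable
  have : SecondCountableTopology Λ.InfPath := ⟨range Λ.cylinder, countable_range _, rfl⟩
  exact borel_eq_generateFrom_of_subbasis rfl

/-- Any condition on an initial piece of fixed degree cuts out a countable union of cylinders. This
gives the measurability of the shifts and of the prefixing maps. -/
theorem measurableSet_map_mem (q : Fin k → ℕ) (S : Set P) :
    MeasurableSet {x : Λ.InfPath | x.map 0 q zero_le ∈ S} := by
  have := Λ.countable
  have : {x : Λ.InfPath | x.map 0 q zero_le ∈ S}
      = ⋃ a ∈ S ∩ {a | Λ.d a = q}, Λ.cylinder a := by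
    ext x
    simp only [mem_ofPred_eq, mem_iUnion, exists_prop]
    constructor
    · intro h
      exact ⟨_, ⟨h, x.d_map_zero q⟩, x.mem_cylinder_map q⟩
    · rintro ⟨a, ⟨ha, hd⟩, hx⟩
      rw [(mem_cylinder_iff hd).1 hx]; exact ha
  rw [this]
  exact MeasurableSet.biUnion (to_countable _) fun a _ => measurableSet_cylinder a

theorem measurable_of_cylinder {X : Type*} [MeasurableSpace X] {f : X → Λ.InfPath}
    (hf : ∀ a, MeasurableSet (f ⁻¹' Λ.cylinder a)) : Measurable f := by
  refine (measurable_generateFrom (s := range Λ.cylinder) ?_).mono le_rfl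
    (borel_eq_generateFrom Λ).le
  rintro _ ⟨a, rfl⟩
  exact hf a

theorem measurable_shift (m : Fin k → ℕ) :
    Measurable (InfPath.shift m : Λ.InfPath → Λ.InfPath) := by
  refine measurable_of_cylinder fun a => ?_
  have : InfPath.shift m ⁻¹' Λ.cylinder a
      = {x : Λ.InfPath | x.map 0 (Λ.d a + m) zero_le ∈ {c | Λ.tail c m = a}} := by
    ext x
    simp only [mem_preimage, mem_cylinder_iff rfl, x.shift_map_zero, mem_ofPred_eq]
    rw [x.tail_map]
  rw [this]
  exact measurableSet_map_mem _ _

/-- The cylinder sets of the paths whose degree is a multiple of `(1, …, 1)`. -/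
def diagonalCylinders (Λ : KGraph k V P) : Set (Set Λ.InfPath) :=
  {S | ∃ (n : ℕ) (a : P), Λ.d a = (fun _ => n) ∧ Λ.cylinder a = S}

/-- Diagonal degrees are totally ordered, so two such cylinders are nested or disjoint. For
incomparable degrees the intersection need not be a single cylinder. -/
theorem isPiSystem_diagonalCylinders (Λ : KGraph k V P) : IsPiSystem Λ.diagonalCylinders := by
  have key : ∀ (m n : ℕ) (a b : P), m ≤ n → Λ.d a = (fun _ => m) → Λ.d b = (fun _ => n) →
      (Λ.cylinder a ∩ Λ.cylinder b).Nonempty → Λ.cylinder b ⊆ Λ.cylinder a := by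
    rintro m n a b hmn ha hb ⟨x, hxa, hxb⟩ y hy
    have hmn' : (fun _ => m : Fin k → ℕ) ≤ fun _ => n := fun _ => hmn
    rw [mem_cylinder_iff ha] at hxa ⊢
    rw [mem_cylinder_iff hb] at hxb hy
    rw [← y.head_map hmn', hy, ← hxb, x.head_map hmn', hxa]
  rintro _ ⟨m, a, ha, rfl⟩ _ ⟨n, b, hb, rfl⟩ hne
  rcases le_total m n with h | h
  · exact ⟨n, b, hb, (inter_eq_right.2 (key m n a b h ha hb hne)).symm⟩
  · exact ⟨m, a, ha, (inter_eq_left.2 (key n m b a h hb ha (inter_comm _ _ ▸ hne))).symm⟩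

theorem generateFrom_diagonalCylinders (Λ : KGraph k V P) :
    (inferInstance : MeasurableSpace Λ.InfPath) = .generateFrom Λ.diagonalCylinders := by
  have := Λ.countable
  apply le_antisymm
  · rw [borel_eq_generateFrom Λ]
    refine MeasurableSpace.generateFrom_le ?_
    rintro _ ⟨a, rfl⟩
    -- Any `n` that bounds every coordinate of the degree works: the cylinder is then the countable
    -- union of the cylinders of its extensions of degree `(n, …, n)`.
    set n := ∑ i, Λ.d a i
    have hn : Λ.d a ≤ fun _ => n := fun i => Finset.single_le_sum (f := Λ.d a)
      (fun _ _ => Nat.zero_le _) (Finset.mem_univ i)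
    have : Λ.cylinder a
        = ⋃ b ∈ {b | Λ.d b = (fun _ => n) ∧ Λ.head b (Λ.d a) = a}, Λ.cylinder b := by
      ext x
      simp only [mem_iUnion, exists_prop, mem_ofPred_eq]
      constructor
      · intro h
        refine ⟨_, ⟨x.d_map_zero _, ?_⟩, x.mem_cylinder_map _⟩
        rw [x.head_map hn]; exact h
      · rintro ⟨b, ⟨hb, hba⟩, hx⟩
        rw [mem_cylinder_iff rfl, ← x.head_map hn, (mem_cylinder_iff hb).1 hx, hba]
    rw [this]
    exact MeasurableSet.biUnion (to_countable _) fun b hb =>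
      MeasurableSpace.measurableSet_generateFrom ⟨n, b, hb.1, rfl⟩
  · refine MeasurableSpace.generateFrom_le ?_
    rintro _ ⟨n, a, -, rfl⟩
    exact measurableSet_cylinder a

/-- A measure that is finite on the sets `Z(v)` is determined by its values on the cylinder
sets of the paths whose degree is a multiple of `(1, …, 1)`. -/
theorem measure_ext [Countable V] {μ ν : Measure Λ.InfPath}
    (hfin : ∀ w, μ (Λ.cylinder (Λ.idp w)) ≠ ∞)
    (h : ∀ (n : ℕ) (a : P), Λ.d a = (fun _ => n) → μ (Λ.cylinder a) = ν (Λ.cylinder a)) :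
    μ = ν := by
  refine Measure.ext_of_generateFrom_of_cover_subset (T := range fun w => Λ.cylinder (Λ.idp w))
    (generateFrom_diagonalCylinders Λ) (isPiSystem_diagonalCylinders Λ) ?_ (countable_range _) ?_
    ?_ ?_
  · rintro _ ⟨w, rfl⟩
    exact ⟨0, _, Λ.d_idp w, rfl⟩
  · exact eq_univ_of_forall fun x =>
      ⟨_, ⟨x.obj 0, rfl⟩, mem_cylinder_idp.2 rfl⟩
  · rintro _ ⟨w, rfl⟩
    exact hfin w
  · rintro _ ⟨n, a, ha, rfl⟩
    exact h n a ha

/-! ### Prefixing maps as maps on the whole path space -/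

open Classical in
/-- The prefixing map `σ_λ`, extended by the identity outside `Z(s(λ))`. -/
def pre (a : P) (x : Λ.InfPath) : Λ.InfPath :=
  if h : x.obj 0 = Λ.s a then x.cons a h else x

theorem stdPrefix_eq (a : P) (x : Λ.cylinder (Λ.idp (Λ.s a))) :
    Λ.stdPrefix a x = pre a x.1 := by
  rw [pre, dif_pos (mem_cylinder_idp.1 x.2)]; rfl

theorem pre_mem {a : P} {x : Λ.InfPath} (hx : x.obj 0 = Λ.s a) : pre a x ∈ Λ.cylinder a := by
  rw [pre, dif_pos hx]; exact InfPath.cons_map a x hx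

theorem shift_pre {a : P} {x : Λ.InfPath} (hx : x.obj 0 = Λ.s a) :
    (pre a x).shift (Λ.d a) = x := by
  rw [pre, dif_pos hx, InfPath.shift_cons]

theorem pre_shift {a : P} {x : Λ.InfPath} (hx : x ∈ Λ.cylinder a) :
    pre a (x.shift (Λ.d a)) = x := by
  have h := mem_cylinder_idp.1 (shift_mem_of_mem_cylinder hx)
  refine InfPath.eq_of_shift_eq (Λ.d a) ?_ (shift_pre h)
  exact ((mem_cylinder_iff rfl).1 (pre_mem h)).trans ((mem_cylinder_iff rfl).1 hx).symm

theorem pre_mem_comp_iff {a b : P} (h : Λ.s a = Λ.r b) {x : Λ.InfPath} (hx : x.obj 0 = Λ.s a) :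
    pre a x ∈ Λ.cylinder (Λ.comp a b h) ↔ x ∈ Λ.cylinder b := by
  rw [mem_cylinder_comp, shift_pre hx, and_iff_right (pre_mem hx)]

theorem pre_pre {a b : P} (h : Λ.s a = Λ.r b) {x : Λ.InfPath} (hx : x.obj 0 = Λ.s b) :
    pre a (pre b x) = pre (Λ.comp a b h) x := by
  have h1 : (pre b x).obj 0 = Λ.s a := (obj_zero_of_mem_cylinder (pre_mem hx)).trans h.symm
  have hx' : x.obj 0 = Λ.s (Λ.comp a b h) := hx.trans (Λ.s_comp a b h).symm
  refine InfPath.eq_of_shift_eq (Λ.d (Λ.comp a b h)) ?_ ?_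
  · rw [(mem_cylinder_iff rfl).1 (pre_mem hx')]
    exact (pre_mem_comp_iff h h1).2 (pre_mem hx)
  · rw [shift_pre hx', Λ.d_comp, add_comm, ← InfPath.shift_shift, shift_pre h1, shift_pre hx]

theorem pre_idp {w : V} {x : Λ.InfPath} (hx : x.obj 0 = w) : pre (Λ.idp w) x = x := by
  have h : x.obj 0 = Λ.s (Λ.idp w) := hx.trans (Λ.s_idp w).symm
  have e := shift_pre h
  have e0 : ∀ y : Λ.InfPath, y.shift 0 = y := fun y => InfPath.ext_map_zero fun p => by
    rw [y.shift_map_zero]; exact y.map_congr rfl (add_zero p) _ _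
  rwa [Λ.d_idp, e0] at e

theorem measurable_pre (a : P) : Measurable (pre a : Λ.InfPath → Λ.InfPath) := by
  refine measurable_of_cylinder fun b => ?_
  -- The first set describes the points that are really prefixed, through their initial piece of
  -- degree `d(b)`; the second describes those that `pre` leaves fixed.
  have : pre a ⁻¹' Λ.cylinder b
      = (Λ.cylinder (Λ.idp (Λ.s a)) ∩ {x : Λ.InfPath | x.map 0 (Λ.d b) zero_le ∈
          {c | ∃ h : Λ.s a = Λ.r c, Λ.head (Λ.comp a c h) (Λ.d b) = b}})
        ∪ (Λ.cylinder b \ Λ.cylinder (Λ.idp (Λ.s a))) := by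
    ext x
    simp only [mem_preimage, mem_union, mem_inter_iff, mem_sdiff, mem_cylinder_idp, mem_ofPred_eq]
    by_cases hx : x.obj 0 = Λ.s a
    · simp only [hx, true_and, not_true_eq_false, and_false, or_false]
      rw [pre, dif_pos hx, mem_cylinder_iff rfl, InfPath.cons_map_zero]
      exact ⟨fun h => ⟨_, h⟩, fun h => h.2⟩
    · simp [pre, hx]
  rw [this]
  exact ((measurableSet_cylinder _).inter (measurableSet_map_mem _ _)).union
    ((measurableSet_cylinder _).diff (measurableSet_cylinder _))

theorem range_stdPrefix (a : P) : range (Λ.stdPrefix a) = Λ.cylinder a := by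
  ext x
  constructor
  · rintro ⟨y, rfl⟩
    rw [stdPrefix_eq]; exact pre_mem (mem_cylinder_idp.1 y.2)
  · intro hx
    exact ⟨⟨x.shift (Λ.d a), shift_mem_of_mem_cylinder hx⟩, by rw [stdPrefix_eq, pre_shift hx]⟩

theorem measurable_stdPrefix (a : P) : Measurable (Λ.stdPrefix a) := by
  have : Λ.stdPrefix a = fun x => pre a x.1 := funext (stdPrefix_eq a)
  rw [this]
  exact (measurable_pre a).comp measurable_subtype_coe

theorem stdPrefix_injective (a : P) : Function.Injective (Λ.stdPrefix a) := fun x y h => by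
  rw [stdPrefix_eq, stdPrefix_eq] at h
  have := congrArg (InfPath.shift (Λ.d a)) h
  rw [shift_pre (mem_cylinder_idp.1 x.2), shift_pre (mem_cylinder_idp.1 y.2)] at this
  exact Subtype.ext this

/-- The image of `E ∩ Z(s(λ))` under `σ_λ`. -/
theorem image_stdPrefix (a : P) (E : Set Λ.InfPath) :
    Λ.stdPrefix a '' (Subtype.val ⁻¹' E) = Λ.cylinder a ∩ InfPath.shift (Λ.d a) ⁻¹' E := by
  ext x
  constructor
  · rintro ⟨y, hy, rfl⟩
    rw [stdPrefix_eq]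
    have h := mem_cylinder_idp.1 y.2
    exact ⟨pre_mem h, by rw [mem_preimage, shift_pre h]; exact hy⟩
  · rintro ⟨hx, hE⟩
    exact ⟨⟨x.shift (Λ.d a), shift_mem_of_mem_cylinder hx⟩, hE, by rw [stdPrefix_eq, pre_shift hx]⟩

theorem measurableSet_image_stdPrefix (a : P) {E : Set (Λ.cylinder (Λ.idp (Λ.s a)))}
    (hE : MeasurableSet E) : MeasurableSet (Λ.stdPrefix a '' E) := by
  obtain ⟨E', hE', rfl⟩ := hE
  rw [image_stdPrefix]
  exact (measurableSet_cylinder a).inter (measurable_shift _ hE')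

end KGraph

/-! ### Weighted composition operators between `L²`-spaces -/

section WeightedComp

open scoped NNReal

variable {X Y Z : Type*} [MeasurableSpace X] [MeasurableSpace Y] [MeasurableSpace Z]

/-- The condition under which `ξ ↦ w · (ξ ∘ φ)` is a contraction from `L²(ν₁)` to `L²(ν₂)`. -/
structure IsContractiveWeight (ν₁ : Measure Y) (ν₂ : Measure X) (w : X → ℝ≥0) (φ : X → Y) :
    Prop where
  measurable_weight : Measurable w
  measurable_map : Measurable φ
  le : (ν₂.withDensity fun x => (w x : ℝ≥0∞) ^ 2).map φ ≤ ν₁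

namespace IsContractiveWeight

variable {ν₁ : Measure Y} {ν₂ : Measure X} {w : X → ℝ≥0} {φ : X → Y}
  (H : IsContractiveWeight ν₁ ν₂ w φ)

include H in
theorem measurable_sq : Measurable fun x => (w x : ℝ≥0∞) ^ 2 :=
  H.measurable_weight.coe_nnreal_ennreal.pow_const 2

include H in
-- The map `φ` need not pull null sets back to null sets, but it does so where the weight is
-- nonzero. This is what makes `w · (ξ ∘ φ)` well defined on classes of functions.
theorem ae_comp {p : Y → Prop} (hp : ∀ᵐ y ∂ν₁, p y) : ∀ᵐ x ∂ν₂, w x ≠ 0 → p (φ x) := by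
  have h1 := ae_of_ae_map H.measurable_map.aemeasurable
    ((Measure.absolutelyContinuous_of_le H.le).ae_le hp)
  rw [ae_withDensity_iff H.measurable_sq] at h1
  filter_upwards [h1] with x hx hw
  exact hx (by simpa using hw)

include H in
theorem eLpNorm_le {f : Y → ℂ} (hf : StronglyMeasurable f) :
    eLpNorm (fun x => (w x : ℝ) • f (φ x)) 2 ν₂ ≤ eLpNorm f 2 ν₁ := by
  rw [eLpNorm_eq_lintegral_rpow_enorm_toReal two_ne_zero ENNReal.ofNat_ne_top,
    eLpNorm_eq_lintegral_rpow_enorm_toReal two_ne_zero ENNReal.ofNat_ne_top]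
  refine ENNReal.rpow_le_rpow ?_ (by positivity)
  simp only [ENNReal.toReal_ofNat, ENNReal.rpow_ofNat]
  have hm : Measurable fun y => ‖f y‖ₑ ^ 2 := hf.measurable.enorm.pow_const 2
  calc ∫⁻ x, ‖(w x : ℝ) • f (φ x)‖ₑ ^ 2 ∂ν₂
      = ∫⁻ x, ((w x : ℝ≥0∞) ^ 2) * ‖f (φ x)‖ₑ ^ 2 ∂ν₂ := by
        refine lintegral_congr fun x => ?_
        rw [enorm_smul, mul_pow, Real.enorm_of_nonneg (w x).coe_nonneg, ENNReal.ofReal_coe_nnreal]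
    _ = ∫⁻ y, ‖f y‖ₑ ^ 2 ∂((ν₂.withDensity fun x => (w x : ℝ≥0∞) ^ 2).map φ) := by
        rw [lintegral_map hm H.measurable_map]
        exact (lintegral_withDensity_eq_lintegral_mul _ H.measurable_sq
          (hm.comp H.measurable_map)).symm
    _ ≤ ∫⁻ y, ‖f y‖ₑ ^ 2 ∂ν₁ := lintegral_mono' H.le le_rfl

include H in
theorem memLp (ξ : Lp ℂ 2 ν₁) : MemLp (fun x => (w x : ℝ) • ξ (φ x)) 2 ν₂ :=
  ⟨(H.measurable_weight.coe_nnreal_real.stronglyMeasurable.smul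
      ((Lp.stronglyMeasurable ξ).comp_measurable H.measurable_map)).aestronglyMeasurable,
    (H.eLpNorm_le (Lp.stronglyMeasurable ξ)).trans_lt (Lp.memLp ξ).2⟩

/-- The weighted composition operator `ξ ↦ w · (ξ ∘ φ)`. -/
def op : Lp ℂ 2 ν₁ →L[ℂ] Lp ℂ 2 ν₂ :=
  LinearMap.mkContinuous
    { toFun := fun ξ => (H.memLp ξ).toLp _
      map_add' := fun ξ η => by
        refine Lp.ext ?_
        filter_upwards [(H.memLp (ξ + η)).coeFn_toLp, Lp.coeFn_add ((H.memLp ξ).toLp _)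
          ((H.memLp η).toLp _), (H.memLp ξ).coeFn_toLp, (H.memLp η).coeFn_toLp,
          H.ae_comp (Lp.coeFn_add ξ η)] with x h1 h2 h3 h4 h5
        rw [h1, h2, Pi.add_apply, h3, h4]
        rcases eq_or_ne (w x) 0 with h | h
        · simp [h]
        · rw [h5 h, Pi.add_apply, smul_add]
      map_smul' := fun c ξ => by
        refine Lp.ext ?_
        filter_upwards [(H.memLp (c • ξ)).coeFn_toLp, Lp.coeFn_smul c ((H.memLp ξ).toLp _),
          (H.memLp ξ).coeFn_toLp, H.ae_comp (Lp.coeFn_smul c ξ)] with x h1 h2 h3 h5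
        rw [h1, RingHom.id_apply, h2, Pi.smul_apply, h3]
        rcases eq_or_ne (w x) 0 with h | h
        · simp [h]
        · rw [h5 h, Pi.smul_apply, smul_comm] }
    1 fun ξ => by
      rw [one_mul]
      change ‖(H.memLp ξ).toLp _‖ ≤ _
      rw [Lp.norm_toLp, Lp.norm_def]
      exact ENNReal.toReal_mono (Lp.memLp ξ).2.ne (H.eLpNorm_le (Lp.stronglyMeasurable ξ))

theorem coeFn_op (ξ : Lp ℂ 2 ν₁) : H.op ξ =ᵐ[ν₂] fun x => (w x : ℝ) • ξ (φ x) :=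
  (H.memLp ξ).coeFn_toLp

theorem norm_op_le (ξ : Lp ℂ 2 ν₁) : ‖H.op ξ‖ ≤ ‖ξ‖ := by
  change ‖(H.memLp ξ).toLp _‖ ≤ _
  rw [Lp.norm_toLp, Lp.norm_def]
  exact ENNReal.toReal_mono (Lp.memLp ξ).2.ne (H.eLpNorm_le (Lp.stronglyMeasurable ξ))

variable {ν₃ : Measure Z} {w' : Y → ℝ≥0} {ψ : Y → Z} (H' : IsContractiveWeight ν₃ ν₁ w' ψ)

theorem coeFn_op_op (ξ : Lp ℂ 2 ν₃) :
    H.op (H'.op ξ) =ᵐ[ν₂] fun x => ((w x * w' (φ x) : ℝ≥0) : ℝ) • ξ (ψ (φ x)) := by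
  filter_upwards [H.coeFn_op (H'.op ξ), H.ae_comp (H'.coeFn_op ξ)] with x h1 h2
  rw [h1]
  rcases eq_or_ne (w x) 0 with h | h
  · simp [h]
  · rw [h2 h, smul_smul, NNReal.coe_mul]

/-- If the weights and maps compose to `w''` and `φ''`, then so do the operators. -/
theorem op_comp_op {w'' : X → ℝ≥0} {φ'' : X → Z} (H'' : IsContractiveWeight ν₃ ν₂ w'' φ'')
    (hw : ∀ x, w x * w' (φ x) = w'' x) (hφ : ∀ x, w'' x ≠ 0 → ψ (φ x) = φ'' x)
    (ξ : Lp ℂ 2 ν₃) : H.op (H'.op ξ) = H''.op ξ := by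
  refine Lp.ext ?_
  filter_upwards [H.coeFn_op_op H' ξ, H''.coeFn_op ξ] with x h1 h2
  rw [h1, h2, hw]
  rcases eq_or_ne (w'' x) 0 with h | h
  · simp [h]
  · rw [hφ x h]

end IsContractiveWeight

/-- Multiplication by the indicator function of `A` is a contraction. -/
theorem isContractiveWeight_indicator (ν : Measure X) {A : Set X} (hA : MeasurableSet A) :
    IsContractiveWeight ν ν (A.indicator 1) id where
  measurable_weight := measurable_one.indicator hA
  measurable_map := measurable_id
  le := by
    have : (fun x => ((A.indicator 1 x : ℝ≥0) : ℝ≥0∞) ^ 2) = A.indicator 1 := by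
      ext x
      by_cases hx : x ∈ A <;> simp [hx]
    rw [Measure.map_id, this, withDensity_indicator_one hA]
    exact Measure.restrict_le_self

/-- Multiplication by the indicator function of `A`, on `L²(ν)`. -/
def indicatorOp (ν : Measure X) {A : Set X} (hA : MeasurableSet A) : Lp ℂ 2 ν →L[ℂ] Lp ℂ 2 ν :=
  (isContractiveWeight_indicator ν hA).op

theorem coeFn_indicatorOp (ν : Measure X) {A : Set X} (hA : MeasurableSet A) (ξ : Lp ℂ 2 ν) :
    indicatorOp ν hA ξ =ᵐ[ν] A.indicator ξ := by
  filter_upwards [(isContractiveWeight_indicator ν hA).coeFn_op ξ] with x hx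
  rw [indicatorOp, hx]
  by_cases h : x ∈ A <;> simp [h]

theorem indicatorOp_mul_self (ν : Measure X) {A : Set X} (hA : MeasurableSet A) :
    indicatorOp ν hA * indicatorOp ν hA = indicatorOp ν hA := by
  ext1 ξ
  refine (isContractiveWeight_indicator ν hA).op_comp_op _ _ (fun x => ?_) (fun _ _ => rfl) ξ
  by_cases h : x ∈ A <;> simp [h]

theorem star_indicatorOp (ν : Measure X) {A : Set X} (hA : MeasurableSet A) :
    star (indicatorOp ν hA) = indicatorOp ν hA := by
  rw [ContinuousLinearMap.star_eq_adjoint]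
  refine ((ContinuousLinearMap.eq_adjoint_iff _ _).2 fun ξ η => ?_).symm
  rw [L2.inner_def, L2.inner_def]
  refine integral_congr_ae ?_
  filter_upwards [coeFn_indicatorOp ν hA ξ, coeFn_indicatorOp ν hA η] with x h1 h2
  rw [h1, h2]
  by_cases h : x ∈ A <;> simp [h]

theorem indicatorOp_union (ν : Measure X) {A B C : Set X} (hA : MeasurableSet A)
    (hB : MeasurableSet B) (hC : MeasurableSet C) (hAB : Disjoint A B) (h : C = A ∪ B) :
    indicatorOp ν hC = indicatorOp ν hA + indicatorOp ν hB := by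
  subst h
  ext1 ξ
  refine Lp.ext ?_
  filter_upwards [coeFn_indicatorOp ν hA ξ, coeFn_indicatorOp ν hB ξ, coeFn_indicatorOp ν hC ξ,
    Lp.coeFn_add (indicatorOp ν hA ξ) (indicatorOp ν hB ξ)] with x h1 h2 h3 h4
  rw [add_apply, h4, h3, Pi.add_apply, h1, h2,
    indicator_union_of_disjoint hAB]

theorem indicatorOp_biUnion (ν : Measure X) {ι : Type*} (A : ι → Set X)
    (hA : ∀ i, MeasurableSet (A i)) (F : Finset ι)
    (hd : ∀ i ∈ F, ∀ j ∈ F, i ≠ j → Disjoint (A i) (A j)) {C : Set X} (hC : MeasurableSet C)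
    (h : C = ⋃ i ∈ F, A i) : indicatorOp ν hC = ∑ i ∈ F, indicatorOp ν (hA i) := by
  classical
  induction F using Finset.induction_on generalizing C with
  | empty =>
    ext1 ξ
    refine Lp.ext ?_
    filter_upwards [coeFn_indicatorOp ν hC ξ, Lp.coeFn_zero ℂ 2 ν] with x h1 h2
    rw [h1, Finset.sum_empty, zero_apply, h2]
    simp [h]
  | insert i F hi ih =>
    have hC' : MeasurableSet (⋃ i ∈ F, A i) := F.measurableSet_biUnion fun i _ => hA i
    rw [Finset.sum_insert hi, ← ih (fun i hi j hj => hd i (Finset.mem_insert_of_mem hi) j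
      (Finset.mem_insert_of_mem hj)) hC' rfl]
    refine indicatorOp_union ν (hA i) hC' hC ?_ (by rw [h, Finset.set_biUnion_insert])
    rw [disjoint_iUnion₂_right]
    intro j hj
    exact hd i (Finset.mem_insert_self _ _) j (Finset.mem_insert_of_mem hj)
      (by rintro rfl; exact hi hj)

/-- A pair of contractions that are mutually inverse between the ranges of two orthogonal
projections consists of mutually adjoint partial isometries. -/
theorem adjoint_of_contractions {H : Type*} [NormedAddCommGroup H] [InnerProductSpace ℂ H]
    [CompleteSpace H] {S T p q : H →L[ℂ] H} (hS : ∀ ξ, ‖S ξ‖ ≤ ‖ξ‖) (hT : ∀ ξ, ‖T ξ‖ ≤ ‖ξ‖)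
    (hp : p * p = p) (hp' : star p = p) (hq' : star q = q) (hTS : T * S = p) (hST : S * T = q)
    (hSp : S * p = S) (hqS : q * S = S) (hpT : p * T = T) : star S = T := by
  -- The bound on `S` gives one inequality through `S = S p`, the bound on `T` the other through `p
  -- = T S`.
  have hn : ∀ ξ, ‖S ξ‖ = ‖p ξ‖ := fun ξ => by
    apply le_antisymm
    · calc ‖S ξ‖ = ‖S (p ξ)‖ := by rw [← mul_apply_eq_comp, hSp]
        _ ≤ _ := hS _
    · calc ‖p ξ‖ = ‖T (S ξ)‖ := by rw [← mul_apply_eq_comp, hTS]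
        _ ≤ _ := hT _
  have hSS : star S * S = p := by
    -- Over `ℂ` an operator is determined by its quadratic form (polarization), and the two forms
    -- here are `‖S ξ‖²` and `‖p ξ‖²`.
    have h : ((star S * S : H →L[ℂ] H) : H →ₗ[ℂ] H) = (p : H →ₗ[ℂ] H) := by
      rw [← ext_inner_map]
      intro ξ
      have h1 : inner ℂ ((star S * S) ξ) ξ = inner ℂ (S ξ) (S ξ) := by
        rw [mul_apply_eq_comp, ContinuousLinearMap.star_eq_adjoint,
          ContinuousLinearMap.adjoint_inner_left]
      have h2 : inner ℂ (p ξ) ξ = inner ℂ (p ξ) (p ξ) := by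
        conv_lhs => rw [← hp, mul_apply_eq_comp]
        conv_lhs => rw [← hp', ContinuousLinearMap.star_eq_adjoint,
          ContinuousLinearMap.adjoint_inner_left, ← ContinuousLinearMap.star_eq_adjoint, hp']
      change inner ℂ ((star S * S) ξ) ξ = inner ℂ (p ξ) ξ
      rw [h1, h2, inner_self_eq_norm_sq_to_K, inner_self_eq_norm_sq_to_K, hn]
    exact ContinuousLinearMap.coe_injective h
  calc star S = star (q * S) := by rw [hqS]
    _ = star S * q := by rw [star_mul, hq']
    _ = star S * S * T := by rw [mul_assoc, hST]
    _ = T := by rw [hSS, hpT]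

end WeightedComp

namespace KGraph

open scoped NNReal

/-! ### Quasi-invariant measures on the path space -/

section Scaling

variable {k : ℕ} {V P : Type*} {Λ : KGraph k V P}

/-- `M` is scaled by the constant `c λ` under the prefixing map `σ_λ`, for each path `λ`. -/
structure IsScaling (M : Measure Λ.InfPath) (c : P → ℝ≥0) : Prop where
  ne_zero : ∀ a, c a ≠ 0
  comp : ∀ a b h, c (Λ.comp a b h) = c a * c b
  measure_comp : ∀ a b h, M (Λ.cylinder (Λ.comp a b h)) = c a * M (Λ.cylinder b)

/-- The shift inverts the prefixing map on `Z(a)`, so the pullback along `σ_a` can be replaced by a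
push-forward, which is easier to compute with. -/
theorem compMeasure_stdPrefix (μ : Measure Λ.InfPath) (a : P) :
    compMeasure μ (Λ.cylinder (Λ.idp (Λ.s a))) (Λ.stdPrefix a)
      = (μ.restrict (Λ.cylinder a)).map (InfPath.shift (Λ.d a)) := by
  ext E hE
  rw [compMeasure, Measure.map_apply measurable_subtype_coe hE,
    Measure.map_apply (measurable_shift _) hE, Measure.restrict_apply (measurable_shift _ hE),
    Measure.comap_apply _ (stdPrefix_injective a) (fun s hs => measurableSet_image_stdPrefix a hs)
      _ (measurable_subtype_coe hE), image_stdPrefix, inter_comm]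

namespace IsScaling

variable [Countable V] {M : Measure Λ.InfPath} [IsFiniteMeasure M] {c : P → ℝ≥0}
  (hM : IsScaling M c)

include hM in
omit [Countable V] [IsFiniteMeasure M] in
theorem idp (w : V) : c (Λ.idp w) = 1 := by
  have h := hM.comp (Λ.idp w) (Λ.idp (Λ.s (Λ.idp w))) (Λ.r_idp _).symm
  rw [Λ.comp_idp] at h
  have h1 : Λ.idp (Λ.s (Λ.idp w)) = Λ.idp w := by rw [Λ.s_idp]
  rw [h1] at h
  exact (mul_eq_left₀ (hM.ne_zero _)).1 h.symm

include hM in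
-- It suffices to test a diagonal cylinder `Z(b)`: its preimage inside `Z(a)` is `Z(ab)` when the
-- product exists, and otherwise both sides vanish.
theorem map_shift (a : P) : (M.restrict (Λ.cylinder a)).map (InfPath.shift (Λ.d a))
    = (c a : ℝ≥0∞) • M.restrict (Λ.cylinder (Λ.idp (Λ.s a))) := by
  refine measure_ext (fun w => ?_) fun n b hb => ?_
  · rw [Measure.map_apply (measurable_shift _) (measurableSet_cylinder _)]
    exact measure_ne_top _ _
  · rw [Measure.map_apply (measurable_shift _) (measurableSet_cylinder _),
      Measure.restrict_apply (measurable_shift _ (measurableSet_cylinder _)),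
      Measure.smul_apply, Measure.restrict_apply (measurableSet_cylinder _), smul_eq_mul]
    by_cases h : Λ.s a = Λ.r b
    · have h1 : InfPath.shift (Λ.d a) ⁻¹' Λ.cylinder b ∩ Λ.cylinder a
          = Λ.cylinder (Λ.comp a b h) := by
        ext x
        rw [mem_cylinder_comp, and_comm]; rfl
      have h2 : Λ.cylinder b ∩ Λ.cylinder (Λ.idp (Λ.s a)) = Λ.cylinder b := by
        refine inter_eq_left.2 fun x hx => ?_
        rw [mem_cylinder_idp, obj_zero_of_mem_cylinder hx, h]
      rw [h1, h2, hM.measure_comp]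
    · have h1 : InfPath.shift (Λ.d a) ⁻¹' Λ.cylinder b ∩ Λ.cylinder a = ∅ := by
        refine eq_empty_of_forall_notMem fun x hx => h ?_
        rw [← mem_cylinder_idp.1 (shift_mem_of_mem_cylinder hx.2), obj_zero_of_mem_cylinder hx.1]
      have h2 : Λ.cylinder b ∩ Λ.cylinder (Λ.idp (Λ.s a)) = ∅ := by
        refine eq_empty_of_forall_notMem fun x hx => h ?_
        rw [← mem_cylinder_idp.1 hx.2, obj_zero_of_mem_cylinder hx.1]
      rw [h1, h2, measure_empty, mul_zero]

include hM in
theorem map_pre (a : P) :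
    (c a : ℝ≥0∞) • (M.restrict (Λ.cylinder (Λ.idp (Λ.s a)))).map (pre a)
      = M.restrict (Λ.cylinder a) := by
  rw [← Measure.map_smul, ← hM.map_shift, Measure.map_map (measurable_pre a) (measurable_shift _)]
  conv_rhs => rw [← Measure.map_id (μ := M.restrict (Λ.cylinder a))]
  refine Measure.map_congr ?_
  filter_upwards [ae_restrict_mem (measurableSet_cylinder a)] with x hx
  exact pre_shift hx

variable {μ : Measure Λ.InfPath} {h : Λ.InfPath → ℝ≥0}

include hM in
-- Change of variables along `y ↦ a y`, which multiplies `M` by `c a`: the density `h(ay)` of `μ` at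
-- the image is divided by its density `h(y)` at the start.
theorem map_shift_withDensity (hh : Measurable h) (h0 : ∀ x, h x ≠ 0)
    (hμ : μ = M.withDensity fun x => (h x : ℝ≥0∞)) (a : P) :
    (μ.restrict (Λ.cylinder a)).map (InfPath.shift (Λ.d a))
      = μ.withDensity fun y => (((Λ.cylinder (Λ.idp (Λ.s a))).indicator
          (fun y => c a * h (pre a y) * (h y)⁻¹) y : ℝ≥0) : ℝ≥0∞) := by
  have hg : Measurable fun y => ((Λ.cylinder (Λ.idp (Λ.s a))).indicator
      (fun y => c a * h (pre a y) * (h y)⁻¹) y : ℝ≥0) :=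
    ((measurable_const.mul (hh.comp (measurable_pre a))).mul hh.inv).indicator
      (measurableSet_cylinder _)
  have hhE : Measurable fun x => (h x : ℝ≥0∞) := hh.coe_nnreal_ennreal
  subst hμ
  rw [restrict_withDensity (measurableSet_cylinder a), ← withDensity_mul _ hhE
    hg.coe_nnreal_ennreal]
  ext E hE
  have hE' := measurable_shift (Λ := Λ) (Λ.d a) hE
  rw [Measure.map_apply (measurable_shift _) hE, withDensity_apply _ hE', withDensity_apply _ hE,
    ← lintegral_indicator hE', ← hM.map_pre, lintegral_smul_measure,
    lintegral_map (hhE.indicator hE') (measurable_pre a), smul_eq_mul]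
  refine (lintegral_const_mul _ ((hhE.indicator hE').comp (measurable_pre a))).symm.trans ?_
  rw [← lintegral_indicator (measurableSet_cylinder _), ← lintegral_indicator hE]
  refine lintegral_congr fun y => ?_
  by_cases hy : y ∈ Λ.cylinder (Λ.idp (Λ.s a))
  · have e := shift_pre (mem_cylinder_idp.1 hy)
    by_cases hyE : y ∈ E
    · rw [indicator_of_mem hy, indicator_of_mem hyE, Function.comp_apply,
        indicator_of_mem (show pre a y ∈ _ by rw [mem_preimage, e]; exact hyE), Pi.mul_apply, indicator_of_mem hy, ← ENNReal.coe_mul,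
        ← ENNReal.coe_mul, ENNReal.coe_inj]
      field_simp [h0 y]
    · rw [indicator_of_mem hy, indicator_of_notMem hyE, Function.comp_apply,
        indicator_of_notMem (show pre a y ∉ _ by rw [mem_preimage, e]; exact hyE), mul_zero]
  · rw [indicator_of_notMem hy]
    by_cases hyE : y ∈ E
    · rw [indicator_of_mem hyE, Pi.mul_apply, indicator_of_notMem hy, ENNReal.coe_zero, mul_zero]
    · rw [indicator_of_notMem hyE]

include hM in
theorem prefixDeriv_ae_eq (hh : Measurable h) (h0 : ∀ x, h x ≠ 0)
    (hμ : μ = M.withDensity fun x => (h x : ℝ≥0∞)) (a : P) :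
    prefixDeriv μ (Λ.cylinder (Λ.idp (Λ.s a))) (Λ.stdPrefix a)
      =ᵐ[μ] fun y => (((Λ.cylinder (Λ.idp (Λ.s a))).indicator
          (fun y => c a * h (pre a y) * (h y)⁻¹) y : ℝ≥0) : ℝ≥0∞) := by
  have hg : Measurable fun y => ((Λ.cylinder (Λ.idp (Λ.s a))).indicator
      (fun y => c a * h (pre a y) * (h y)⁻¹) y : ℝ≥0) :=
    ((measurable_const.mul (hh.comp (measurable_pre a))).mul hh.inv).indicator
      (measurableSet_cylinder _)
  have : SigmaFinite μ := by
    rw [hμ]; exact SigmaFinite.withDensity _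
  rw [prefixDeriv, compMeasure_stdPrefix, hM.map_shift_withDensity hh h0 hμ]
  exact Measure.rnDeriv_withDensity _ hg.coe_nnreal_ennreal

include hM in
-- The covering, disjointness and composition conditions hold pointwise, with no exceptional null
-- sets; the density enters only in the conditions on derivatives and in the positivity of the
-- vertex sets.
theorem standardSemibranching (hpos : ∀ w, 0 < M (Λ.cylinder (Λ.idp w))) (hh : Measurable h)
    (h0 : ∀ x, h x ≠ 0) (hμ : μ = M.withDensity fun x => (h x : ℝ≥0∞)) :
    Λ.StandardSemibranching μ where
  semibranching m :=
    { measurableSet_dom := fun a => measurableSet_cylinder _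
      measurable := fun a => measurable_stdPrefix _
      injective := fun a => stdPrefix_injective _
      measurableSet_image := fun a E hE => measurableSet_image_stdPrefix _ hE
      cover := by
        simp only [range_stdPrefix]
        rw [iUnion_cylinder, compl_univ, measure_empty]
      disjoint := fun a b hab => by
        rw [range_stdPrefix, range_stdPrefix, (disjoint_cylinder (a.2.trans b.2.symm)
          (fun e => hab (Subtype.ext e))).inter_eq, measure_empty]
      hasDeriv := fun a => by
        rw [withDensity_congr_ae (hM.prefixDeriv_ae_eq hh h0 hμ a), compMeasure_stdPrefix,
          hM.map_shift_withDensity hh h0 hμ]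
      deriv_pos := fun a => by
        filter_upwards [hM.prefixDeriv_ae_eq hh h0 hμ a] with x hx hxD
        rw [hx, indicator_of_mem hxD]
        refine ⟨ENNReal.coe_pos.2 ?_, ENNReal.coe_lt_top⟩
        exact pos_iff_ne_zero.2 (mul_ne_zero (mul_ne_zero (hM.ne_zero a) (h0 _))
          (inv_ne_zero (h0 _))) }
  coding m := by
    refine ⟨measurable_shift m, ?_⟩
    rintro ⟨a, rfl⟩ x
    refine (congrArg (InfPath.shift (Λ.d a)) (stdPrefix_eq a x)).trans ?_
    exact shift_pre (mem_cylinder_idp.1 x.2)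
  vertex_id w x := by
    rw [stdPrefix_eq, pre_idp ((mem_cylinder_idp.1 x.2).trans (Λ.s_idp w))]
  vertex_pos w := by
    rw [Λ.s_idp, hμ]
    -- Since `h` vanishes nowhere, a set that is null for `h M` is null for `M`.
    refine pos_iff_ne_zero.2 fun hz => (hpos w).ne' ?_
    rw [withDensity_apply_eq_zero hh.coe_nnreal_ennreal] at hz
    convert hz using 2
    ext x
    simp [h0]
  range_subset a b hab := by
    rw [range_stdPrefix, sdiff_eq_empty.2, measure_empty]
    intro x hx
    rw [mem_cylinder_idp, obj_zero_of_mem_cylinder hx, hab]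
  dom_comp a b hab := by rw [Λ.s_comp]; exact Filter.EventuallyEq.rfl
  prefix_comp a b hab := by
    refine Filter.Eventually.of_forall fun x hx => ?_
    have hx' := mem_cylinder_idp.1 hx
    refine ⟨?_, ?_, ?_⟩
    · rw [stdPrefix_eq, mem_cylinder_idp, obj_zero_of_mem_cylinder (pre_mem hx'), hab]
    · rwa [Λ.s_comp]
    · simp only [stdPrefix_eq]
      exact pre_pre hab hx'
  coding_add m n := funext fun x => x.shift_shift m n

/-! ### The representation on `L²` of a scaled measure -/

omit [Countable V] [IsFiniteMeasure M] in
theorem withDensity_indicator_sq {A : Set Λ.InfPath} (hA : MeasurableSet A) (r : ℝ≥0) :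
    (M.withDensity fun x => ((A.indicator (fun _ => r) x : ℝ≥0) : ℝ≥0∞) ^ 2)
      = ((r ^ 2 : ℝ≥0) : ℝ≥0∞) • M.restrict A := by
  have : (fun x => ((A.indicator (fun _ => r) x : ℝ≥0) : ℝ≥0∞) ^ 2)
      = ((r ^ 2 : ℝ≥0) : ℝ≥0∞) • A.indicator 1 := by
    ext x
    by_cases hx : x ∈ A <;> simp [hx]
  rw [this, withDensity_smul _ (measurable_one.indicator hA), withDensity_indicator_one hA]

include hM in
-- The squared weight `(c a)⁻¹` cancels the factor `c a` by which the shift pushes `M` on `Z(a)`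
-- forward.
theorem isContractiveWeight_shift (a : P) :
    IsContractiveWeight M M ((Λ.cylinder a).indicator fun _ => (NNReal.sqrt (c a))⁻¹)
      (InfPath.shift (Λ.d a)) where
  measurable_weight := measurable_const.indicator (measurableSet_cylinder a)
  measurable_map := measurable_shift _
  le := by
    rw [withDensity_indicator_sq (measurableSet_cylinder a), Measure.map_smul, hM.map_shift,
      smul_smul, ← ENNReal.coe_mul, inv_pow, NNReal.sq_sqrt, inv_mul_cancel₀ (hM.ne_zero a),
      ENNReal.coe_one, one_smul]
    exact Measure.restrict_le_self

include hM in
theorem isContractiveWeight_pre (a : P) :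
    IsContractiveWeight M M ((Λ.cylinder (Λ.idp (Λ.s a))).indicator fun _ => NNReal.sqrt (c a))
      (pre a) where
  measurable_weight := measurable_const.indicator (measurableSet_cylinder _)
  measurable_map := measurable_pre a
  le := by
    rw [withDensity_indicator_sq (measurableSet_cylinder _), Measure.map_smul, NNReal.sq_sqrt,
      hM.map_pre]
    exact Measure.restrict_le_self

/-- The operator `S_λ`. -/
def creation (a : P) : Lp ℂ 2 M →L[ℂ] Lp ℂ 2 M := (hM.isContractiveWeight_shift a).op

/-- The adjoint of `S_λ`. -/
def annihilation (a : P) : Lp ℂ 2 M →L[ℂ] Lp ℂ 2 M := (hM.isContractiveWeight_pre a).op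

theorem annihilation_mul_creation (a : P) :
    hM.annihilation a * hM.creation a
      = indicatorOp M (measurableSet_cylinder (Λ.idp (Λ.s a))) := by
  ext1 ξ
  refine (hM.isContractiveWeight_pre a).op_comp_op (hM.isContractiveWeight_shift a)
    (isContractiveWeight_indicator M (measurableSet_cylinder _)) (fun x => ?_) (fun x hx => ?_) ξ
  · by_cases hx : x ∈ Λ.cylinder (Λ.idp (Λ.s a))
    · rw [indicator_of_mem hx, indicator_of_mem (pre_mem (mem_cylinder_idp.1 hx)),
        indicator_of_mem hx, mul_inv_cancel₀ (by simpa using hM.ne_zero a), Pi.one_apply]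
    · rw [indicator_of_notMem hx, indicator_of_notMem hx, zero_mul]
  · exact shift_pre (mem_cylinder_idp.1 (mem_of_indicator_ne_zero hx))

theorem creation_mul_annihilation (a : P) :
    hM.creation a * hM.annihilation a = indicatorOp M (measurableSet_cylinder a) := by
  ext1 ξ
  refine (hM.isContractiveWeight_shift a).op_comp_op (hM.isContractiveWeight_pre a)
    (isContractiveWeight_indicator M (measurableSet_cylinder _)) (fun x => ?_) (fun x hx => ?_) ξ
  · by_cases hx : x ∈ Λ.cylinder a
    · rw [indicator_of_mem hx, indicator_of_mem (shift_mem_of_mem_cylinder hx),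
        indicator_of_mem hx, inv_mul_cancel₀ (by simpa using hM.ne_zero a), Pi.one_apply]
    · rw [indicator_of_notMem hx, indicator_of_notMem hx, zero_mul]
  · exact pre_shift (mem_of_indicator_ne_zero hx)

theorem creation_mul_creation (a b : P) (hab : Λ.s a = Λ.r b) :
    hM.creation a * hM.creation b = hM.creation (Λ.comp a b hab) := by
  ext1 ξ
  refine (hM.isContractiveWeight_shift a).op_comp_op (hM.isContractiveWeight_shift b)
    (hM.isContractiveWeight_shift _) (fun x => ?_) (fun x hx => ?_) ξ
  · by_cases hx : x ∈ Λ.cylinder (Λ.comp a b hab)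
    · obtain ⟨h1, h2⟩ := (mem_cylinder_comp hab).1 hx
      rw [indicator_of_mem hx, indicator_of_mem h1, indicator_of_mem h2, hM.comp, NNReal.sqrt_mul,
        mul_inv]
    · rw [indicator_of_notMem hx]
      rw [mem_cylinder_comp hab, not_and_or] at hx
      rcases hx with hx | hx
      · rw [indicator_of_notMem hx, zero_mul]
      · rw [indicator_of_notMem hx, mul_zero]
  · rw [InfPath.shift_shift, Λ.d_comp, add_comm]

theorem creation_idp (w : V) :
    hM.creation (Λ.idp w) = indicatorOp M (measurableSet_cylinder (Λ.idp w)) := by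
  ext1 ξ
  refine Lp.ext ?_
  filter_upwards [(hM.isContractiveWeight_shift (Λ.idp w)).coeFn_op ξ,
    coeFn_indicatorOp M (measurableSet_cylinder (Λ.idp w)) ξ] with x h1 h2
  rw [creation, h1, h2]
  by_cases hx : x ∈ Λ.cylinder (Λ.idp w)
  · have e := pre_shift hx
    rw [pre_idp (by rw [mem_cylinder_idp.1 (shift_mem_of_mem_cylinder hx), Λ.s_idp])] at e
    simp [hx, hM.idp, e]
  · simp [hx]

/-- Both operators are contractions by construction and their two products are the expected
projections, so `adjoint_of_contractions` gives the adjoint without computing inner products. -/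
theorem star_creation (a : P) : star (hM.creation a) = hM.annihilation a := by
  have h1 := hM.annihilation_mul_creation a
  have h2 := hM.creation_mul_annihilation a
  have hp := hM.creation_idp (Λ.s a)
  refine adjoint_of_contractions (fun ξ => (hM.isContractiveWeight_shift a).norm_op_le ξ)
    (fun ξ => (hM.isContractiveWeight_pre a).norm_op_le ξ)
    (indicatorOp_mul_self M (measurableSet_cylinder (Λ.idp (Λ.s a)))) (star_indicatorOp M _)
    (star_indicatorOp M (measurableSet_cylinder a)) h1 h2 ?_ ?_ ?_
  · rw [← hp, hM.creation_mul_creation a _ (Λ.r_idp _).symm, Λ.comp_idp]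
  · rw [← h2, mul_assoc, h1, ← hp, hM.creation_mul_creation a _ (Λ.r_idp _).symm, Λ.comp_idp]
  · ext1 ξ
    refine (isContractiveWeight_indicator M (measurableSet_cylinder _)).op_comp_op (hM.isContractiveWeight_pre a)
      (hM.isContractiveWeight_pre a) (fun x => ?_) (fun _ _ => rfl) ξ
    by_cases hx : x ∈ Λ.cylinder (Λ.idp (Λ.s a))
    · rw [indicator_of_mem hx, Pi.one_apply, one_mul]; rfl
    · rw [indicator_of_notMem hx, indicator_of_notMem hx, zero_mul]

theorem isCuntzKrieger_creation : Λ.IsCuntzKrieger hM.creation where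
  partial_isometry a := by
    rw [star_creation, mul_assoc, annihilation_mul_creation, ← hM.creation_idp,
      hM.creation_mul_creation a _ (Λ.r_idp _).symm, Λ.comp_idp]
  ck1_proj w := by
    rw [creation_idp]
    exact ⟨indicatorOp_mul_self M _, star_indicatorOp M _⟩
  ck1_orth w w' hne := by
    rw [creation_idp, creation_idp]
    ext1 ξ
    refine Lp.ext ?_
    filter_upwards [(isContractiveWeight_indicator M (measurableSet_cylinder (Λ.idp w))).coeFn_op_op
      (isContractiveWeight_indicator M (measurableSet_cylinder (Λ.idp w'))) ξ,
      Lp.coeFn_zero ℂ 2 M] with x h1 h2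
    rw [zero_apply, h2]
    refine h1.trans ?_
    by_cases hx : x ∈ Λ.cylinder (Λ.idp w)
    · have hx' : x ∉ Λ.cylinder (Λ.idp w') := fun h' =>
        hne ((mem_cylinder_idp.1 hx).symm.trans (mem_cylinder_idp.1 h'))
      simp [hx']
    · simp [hx]
  ck2 a b h := hM.creation_mul_creation a b h
  ck3 a := by rw [star_creation, annihilation_mul_creation, creation_idp]
  ck4 w n F hF := by
    simp only [star_creation, creation_mul_annihilation, creation_idp]
    -- The last relation says that the cylinders of the paths in `w Λⁿ` partition `Z(w)`.
    refine indicatorOp_biUnion M _ (fun a => measurableSet_cylinder a) F (fun a ha b hb hab => ?_)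
      _ ?_
    · exact disjoint_cylinder (((hF a).1 ha).2.trans ((hF b).1 hb).2.symm) hab
    · ext x
      simp only [mem_cylinder_idp, mem_iUnion, exists_prop, hF]
      constructor
      · intro hx
        exact ⟨_, ⟨(x.r_map _ _ _).trans hx, x.d_map_zero n⟩, x.mem_cylinder_map n⟩
      · rintro ⟨a, ⟨ha, -⟩, hx⟩
        rw [obj_zero_of_mem_cylinder hx, ha]

end IsScaling

end Scaling

end KGraph

/-! ### Multiplication by the square root of a density -/

section SqrtMul

open scoped NNReal

variable {X : Type*} [MeasurableSpace X] {M μ : Measure X} {h : X → ℝ≥0}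

theorem isContractiveWeight_sqrt (hh : Measurable h)
    (hμ : μ = M.withDensity fun x => (h x : ℝ≥0∞)) :
    IsContractiveWeight μ M (fun x => NNReal.sqrt (h x)) id where
  measurable_weight := NNReal.continuous_sqrt.measurable.comp hh
  measurable_map := measurable_id
  le := by
    simp only [← ENNReal.coe_pow, NNReal.sq_sqrt, Measure.map_id, hμ, le_refl]

theorem isContractiveWeight_inv_sqrt (hh : Measurable h) (h0 : ∀ x, h x ≠ 0)
    (hμ : μ = M.withDensity fun x => (h x : ℝ≥0∞)) :
    IsContractiveWeight M μ (fun x => (NNReal.sqrt (h x))⁻¹) id where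
  measurable_weight := (NNReal.continuous_sqrt.measurable.comp hh).inv
  measurable_map := measurable_id
  le := by
    simp only [← ENNReal.coe_pow, inv_pow, NNReal.sq_sqrt, Measure.map_id, hμ]
    rw [← withDensity_mul _ hh.coe_nnreal_ennreal
      (show Measurable fun x => (((h x)⁻¹ : ℝ≥0) : ℝ≥0∞) from hh.inv.coe_nnreal_ennreal)]
    have : ((fun x => (h x : ℝ≥0∞)) * fun x => (((h x)⁻¹ : ℝ≥0) : ℝ≥0∞)) = 1 := by
      ext x
      rw [Pi.mul_apply, ← ENNReal.coe_mul, mul_inv_cancel₀ (h0 x), ENNReal.coe_one, Pi.one_apply]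
    rw [this, withDensity_one]

/-- The unitary `ξ ↦ √h ξ` from `L²(h M)` to `L²(M)`. -/
def sqrtMul (hh : Measurable h) (h0 : ∀ x, h x ≠ 0)
    (hμ : μ = M.withDensity fun x => (h x : ℝ≥0∞)) : Lp ℂ 2 μ ≃ₗᵢ[ℂ] Lp ℂ 2 M :=
  have e1 : ∀ ξ, (isContractiveWeight_inv_sqrt hh h0 hμ).op
      ((isContractiveWeight_sqrt hh hμ).op ξ) = ξ := fun ξ => by
    refine Lp.ext ?_
    filter_upwards [(isContractiveWeight_inv_sqrt hh h0 hμ).coeFn_op_op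
      (isContractiveWeight_sqrt hh hμ) ξ] with x hx
    rw [hx]
    simp [h0 x]
  have e2 : ∀ ξ, (isContractiveWeight_sqrt hh hμ).op
      ((isContractiveWeight_inv_sqrt hh h0 hμ).op ξ) = ξ := fun ξ => by
    refine Lp.ext ?_
    filter_upwards [(isContractiveWeight_sqrt hh hμ).coeFn_op_op
      (isContractiveWeight_inv_sqrt hh h0 hμ) ξ] with x hx
    rw [hx]
    simp [h0 x]
  { toLinearEquiv :=
      { (isContractiveWeight_sqrt hh hμ).op with
        invFun := (isContractiveWeight_inv_sqrt hh h0 hμ).op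
        left_inv := e1
        right_inv := e2 }
    -- A bijective contraction whose inverse is also a contraction is isometric.
    norm_map' := fun ξ => le_antisymm ((isContractiveWeight_sqrt hh hμ).norm_op_le ξ) <| by
      conv_lhs => rw [← e1 ξ]
      exact (isContractiveWeight_inv_sqrt hh h0 hμ).norm_op_le _ }

theorem sqrtMul_apply (hh : Measurable h) (h0 : ∀ x, h x ≠ 0)
    (hμ : μ = M.withDensity fun x => (h x : ℝ≥0∞)) (ξ : Lp ℂ 2 μ) :
    sqrtMul hh h0 hμ ξ = (isContractiveWeight_sqrt hh hμ).op ξ := rfl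

theorem sqrtMul_symm_apply (hh : Measurable h) (h0 : ∀ x, h x ≠ 0)
    (hμ : μ = M.withDensity fun x => (h x : ℝ≥0∞)) (ξ : Lp ℂ 2 M) :
    (sqrtMul hh h0 hμ).symm ξ = (isContractiveWeight_inv_sqrt hh h0 hμ).op ξ := rfl

/-- Two equivalent σ-finite measures have a positive and finite density. -/
theorem exists_density [SigmaFinite μ] [SigmaFinite M] (h1 : μ ≪ M) (h2 : M ≪ μ) :
    ∃ h : X → ℝ≥0, Measurable h ∧ (∀ x, h x ≠ 0) ∧ μ = M.withDensity fun x => (h x : ℝ≥0∞) := by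
  classical
  have hm : Measurable fun x => (μ.rnDeriv M x).toNNReal :=
    (Measure.measurable_rnDeriv μ M).ennreal_toNNReal
  have hset : MeasurableSet {x | (μ.rnDeriv M x).toNNReal = 0} :=
    hm (measurableSet_singleton 0)
  -- `toNNReal` sends both `0` and `∞` to `0`. By equivalence these values occur only on a null set,
  -- and resetting the density to `1` there makes it nonzero everywhere, not just almost everywhere.
  refine ⟨fun x => if (μ.rnDeriv M x).toNNReal = 0 then 1 else (μ.rnDeriv M x).toNNReal,
    Measurable.ite hset measurable_const hm, fun x => ?_, ?_⟩
  · dsimp only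
    split_ifs with hx
    · exact one_ne_zero
    · exact hx
  · conv_lhs => rw [← Measure.withDensity_rnDeriv_eq μ M h1]
    refine withDensity_congr_ae ?_
    filter_upwards [Measure.rnDeriv_lt_top μ M, h2.ae_le (Measure.rnDeriv_pos h1)] with x hx hx'
    have : (μ.rnDeriv M x).toNNReal ≠ 0 := (ENNReal.toNNReal_pos hx'.ne' hx.ne).ne'
    rw [if_neg this, ENNReal.coe_toNNReal hx.ne]

end SqrtMul

/-- Conjugation by a unitary, as a homomorphism. -/
def conjHom {H K : Type*} [NormedAddCommGroup H] [InnerProductSpace ℂ H] [CompleteSpace H]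
    [NormedAddCommGroup K] [InnerProductSpace ℂ K] [CompleteSpace K] (U : H ≃ₗᵢ[ℂ] K) :
    (H →L[ℂ] H) →⋆ₙₐ[ℂ] (K →L[ℂ] K) where
  toFun := U.conjStarAlgEquiv
  map_smul' := map_smul U.conjStarAlgEquiv
  map_zero' := map_zero U.conjStarAlgEquiv
  map_add' := map_add U.conjStarAlgEquiv
  map_mul' := map_mul U.conjStarAlgEquiv
  map_star' := map_star U.conjStarAlgEquiv

/-! ### Standard representations for measures with a density with respect to a scaled measure -/

namespace KGraph

namespace IsScaling

open scoped NNReal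

variable {k : ℕ} {V : Type} {P : Type u} {Λ : KGraph k V P} [Countable V]
  {M : Measure Λ.InfPath} [IsFiniteMeasure M] {c : P → ℝ≥0} (hM : IsScaling M c)

/-- The representation of `C*(Λ)` on `L²(M)` with `t_λ ↦ S_λ`. -/
def rep : Λ.cstar →⋆ₙₐ[ℂ] (Lp ℂ 2 M →L[ℂ] Lp ℂ 2 M) :=
  (Λ.existsUnique_lift hM.isCuntzKrieger_creation).choose

theorem rep_gen (a : P) : hM.rep (Λ.gen a) = hM.creation a :=
  (Λ.existsUnique_lift hM.isCuntzKrieger_creation).choose_spec.1 a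

variable {μ : Measure Λ.InfPath} {h : Λ.InfPath → ℝ≥0}

/-- With `y = σ^{d(a)} x` one has `a y = x` on `Z(a)`, and the weights combine as `h(x)^{-1/2}
c_a^{-1/2} h(y)^{1/2} = (c_a h(x) / h(y))^{-1/2}`, which is the prescribed power of the derivative
at `y`. -/
theorem coeFn_conj_creation (hh : Measurable h) (h0 : ∀ x, h x ≠ 0)
    (hμ : μ = M.withDensity fun x => (h x : ℝ≥0∞)) (a : P) (ξ : Lp ℂ 2 μ) :
    (sqrtMul hh h0 hμ).symm (hM.creation a (sqrtMul hh h0 hμ ξ)) =ᵐ[μ]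
      (range (Λ.stdPrefix a)).indicator fun x =>
        ((prefixDeriv μ (Λ.cylinder (Λ.idp (Λ.s a))) (Λ.stdPrefix a)
          (InfPath.shift (Λ.d a) x)).toReal ^ (-(1 / 2 : ℝ)) : ℝ) •
            ξ (InfPath.shift (Λ.d a) x) := by
  have hac : μ ≪ M := by rw [hμ]; exact withDensity_absolutelyContinuous _ _
  have hderiv : ∀ᵐ x ∂μ, x ∈ Λ.cylinder a →
      prefixDeriv μ (Λ.cylinder (Λ.idp (Λ.s a))) (Λ.stdPrefix a) (x.shift (Λ.d a))
        = ((c a * h x * (h (x.shift (Λ.d a)))⁻¹ : ℝ≥0) : ℝ≥0∞) := by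
    -- The derivative is known only almost everywhere but is evaluated at the shifted point; `hq`
    -- ensures that exceptional null sets pull back to null sets inside `Z(a)`.
    have hq : (μ.restrict (Λ.cylinder a)).map (InfPath.shift (Λ.d a)) ≪ μ := by
      rw [hM.map_shift_withDensity hh h0 hμ]
      exact withDensity_absolutelyContinuous _ _
    have := ae_of_ae_map (measurable_shift (Λ := Λ) (Λ.d a)).aemeasurable
      (hq.ae_le (hM.prefixDeriv_ae_eq hh h0 hμ a))
    rw [ae_restrict_iff' (measurableSet_cylinder a)] at this
    filter_upwards [this] with x hx hxa
    rw [hx hxa, indicator_of_mem (shift_mem_of_mem_cylinder hxa), pre_shift hxa]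
  rw [sqrtMul_symm_apply, sqrtMul_apply, range_stdPrefix]
  filter_upwards [hderiv, (isContractiveWeight_inv_sqrt hh h0 hμ).coeFn_op
    (hM.creation a ((isContractiveWeight_sqrt hh hμ).op ξ)),
    hac.ae_le ((hM.isContractiveWeight_shift a).coeFn_op_op (isContractiveWeight_sqrt hh hμ) ξ)]
    with x h1 h2 h3
  rw [h2]
  refine (congrArg _ h3).trans ?_
  by_cases hx : x ∈ Λ.cylinder a
  · rw [indicator_of_mem hx, indicator_of_mem hx, h1 hx, smul_smul, ENNReal.coe_toReal,
      ← NNReal.coe_rpow, ← NNReal.coe_mul]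
    congr 2
    rw [NNReal.rpow_neg, ← NNReal.sqrt_eq_rpow, NNReal.sqrt_mul, NNReal.sqrt_mul, NNReal.sqrt_inv,
      mul_inv, mul_inv, inv_inv]
    ring
  · rw [indicator_of_notMem hx, indicator_of_notMem hx]
    simp

/-- A standard representation on `L²(h M)` is intertwined with `rep` by multiplication by `√h`. -/
theorem isStandardRep_iff (hh : Measurable h) (h0 : ∀ x, h x ≠ 0)
    (hμ : μ = M.withDensity fun x => (h x : ℝ≥0∞))
    (π : Λ.cstar →⋆ₙₐ[ℂ] (Lp ℂ 2 μ →L[ℂ] Lp ℂ 2 μ)) :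
    Λ.IsStandardRep μ π ↔ ∀ x ξ, sqrtMul hh h0 hμ (π x ξ) = hM.rep x (sqrtMul hh h0 hμ ξ) := by
  set U := sqrtMul hh h0 hμ
  have hgen : Λ.IsStandardRep μ π ↔
      ∀ a, π (Λ.gen a) = U.symm.conjStarAlgEquiv (hM.creation a) := by
    refine forall_congr' fun a => ?_
    rw [ContinuousLinearMap.ext_iff]
    refine forall_congr' fun ξ => ?_
    have h1 := hM.coeFn_conj_creation hh h0 hμ a ξ
    constructor
    · intro h
      exact Lp.ext (h.trans h1.symm)
    · intro h
      rw [h]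
      exact h1
  -- Uniqueness in the universal property extends agreement from the generators to all of `C*(Λ)`.
  have hlift : (∀ a, U.conjStarAlgEquiv (π (Λ.gen a)) = hM.creation a) ↔
      ∀ x, U.conjStarAlgEquiv (π x) = hM.rep x := by
    constructor
    · intro h
      have := (Λ.existsUnique_lift hM.isCuntzKrieger_creation).unique
        (y₁ := (conjHom U).comp π) h hM.rep_gen
      exact fun x => DFunLike.congr_fun this x
    · intro h a
      rw [h, hM.rep_gen]
  have e1 : Λ.IsStandardRep μ π ↔ ∀ a, U.conjStarAlgEquiv (π (Λ.gen a)) = hM.creation a := by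
    rw [hgen]
    refine forall_congr' fun a => ?_
    rw [← LinearIsometryEquiv.symm_conjStarAlgEquiv, ← StarAlgEquiv.symm_apply_eq,
      StarAlgEquiv.symm_symm]
  rw [e1, hlift]
  refine forall_congr' fun x => ?_
  rw [ContinuousLinearMap.ext_iff]
  constructor
  · intro h ξ
    have := h (U ξ)
    rwa [LinearIsometryEquiv.conjStarAlgEquiv_apply_apply, U.symm_apply_apply] at this
  · intro h ξ
    rw [LinearIsometryEquiv.conjStarAlgEquiv_apply_apply, h, U.apply_symm_apply]

include hM in
theorem existsUnique_standardRep (hh : Measurable h) (h0 : ∀ x, h x ≠ 0)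
    (hμ : μ = M.withDensity fun x => (h x : ℝ≥0∞)) :
    ∃! π : Λ.cstar →⋆ₙₐ[ℂ] (Lp ℂ 2 μ →L[ℂ] Lp ℂ 2 μ), Λ.IsStandardRep μ π := by
  simp only [hM.isStandardRep_iff hh h0 hμ]
  set U := sqrtMul hh h0 hμ
  refine ⟨(conjHom U.symm).comp hM.rep, fun x ξ => ?_,
    fun π hπ => ?_⟩
  · exact U.apply_symm_apply _
  · ext x : 1
    ext1 ξ
    refine U.injective ((hπ x ξ).trans ?_)
    exact (U.apply_symm_apply _).symm

include hM in
theorem unitarilyEquivalent (hh : Measurable h) (h0 : ∀ x, h x ≠ 0)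
    (hμ : μ = M.withDensity fun x => (h x : ℝ≥0∞))
    {π : Λ.cstar →⋆ₙₐ[ℂ] (Lp ℂ 2 μ →L[ℂ] Lp ℂ 2 μ)}
    {ρ : Λ.cstar →⋆ₙₐ[ℂ] (Lp ℂ 2 M →L[ℂ] Lp ℂ 2 M)} (hπ : Λ.IsStandardRep μ π)
    (hρ : Λ.IsStandardRep M ρ) : UnitarilyEquivalent π ρ := by
  have h1 : Measurable fun _ : Λ.InfPath => (1 : ℝ≥0) := measurable_const
  -- Viewing `M` as having density `1` makes `isStandardRep_iff` apply to both representations; the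
  -- two unitaries onto the space of `rep` are then composed.
  have hM1 : M = M.withDensity fun _ => ((1 : ℝ≥0) : ℝ≥0∞) := withDensity_one.symm
  rw [hM.isStandardRep_iff hh h0 hμ] at hπ
  rw [hM.isStandardRep_iff h1 (fun _ => one_ne_zero) hM1] at hρ
  refine ⟨(sqrtMul hh h0 hμ).trans (sqrtMul h1 (fun _ => one_ne_zero) hM1).symm, fun x ξ => ?_⟩
  rw [LinearIsometryEquiv.trans_apply, LinearIsometryEquiv.trans_apply,
    LinearIsometryEquiv.symm_apply_eq, hρ, LinearIsometryEquiv.apply_symm_apply, hπ]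

end IsScaling

end KGraph

/-! ### Absolute continuity of infinite product measures -/

section InfiniteProduct

open scoped NNReal

variable {A : Type*} [Fintype A] [MeasurableSpace A] [DiscreteMeasurableSpace A]

theorem infinitePi_cylinder_eq (m : ℕ → Measure A) [∀ l, IsProbabilityMeasure (m l)] (n : ℕ)
    (q : ℕ → A) :
    Measure.infinitePi m {y | ∀ l < n, y l = q l} = ∏ l ∈ Finset.range n, m l {q l} := by
  rw [← Measure.infinitePi_pi m (fun l _ => measurableSet_singleton (q l))]
  congr 1
  ext y
  simp [Set.mem_pi]

theorem measure_preimage_restrict (μ : Measure (ℕ → A)) (n : ℕ) (T : Finset (Fin n → A)) :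
    μ ((fun (y : ℕ → A) (i : Fin n) => y i) ⁻¹' T)
      = ∑ a ∈ T, μ {y | ∀ i : Fin n, y i = a i} := by
  have hm : Measurable fun (y : ℕ → A) (i : Fin n) => y i :=
    measurable_pi_lambda _ fun i => measurable_pi_apply _
  rw [← Measure.map_apply hm T.measurableSet, ← sum_measure_singleton]
  refine Finset.sum_congr rfl fun a _ => ?_
  rw [Measure.map_apply hm (measurableSet_singleton a)]
  congr 1
  ext y
  simp [funext_iff]

/-- An inequality between two finite measures on a sequence space that holds on all cylinder
sets holds on all open sets. -/
theorem measure_isOpen_le_of_cylinder [TopologicalSpace A] [DiscreteTopology A]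
    {μ ν : Measure (ℕ → A)} {C : ℝ≥0∞}
    (h : ∀ (n : ℕ) (q : ℕ → A), μ {y | ∀ l < n, y l = q l} ≤ C * ν {y | ∀ l < n, y l = q l})
    {U : Set (ℕ → A)} (hU : IsOpen U) : μ U ≤ C * ν U := by
  classical
  -- `S n` is the union of the cylinders of length `n` inside `U`, a finite disjoint union since `A`
  -- is finite. These sets increase to `U`, so continuity from below finishes the argument.
  set S : ℕ → Set (ℕ → A) := fun n => {x | PiNat.cylinder x n ⊆ U}
  have hS : Monotone S := fun m n hmn x hx => (PiNat.cylinder_anti x hmn).trans hx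
  have hSU : ⋃ n, S n = U := by
    refine subset_antisymm (iUnion_subset fun n x hx => hx (PiNat.self_mem_cylinder x n)) ?_
    intro x hx
    obtain ⟨_, ⟨y, n, rfl⟩, hxs, hsU⟩ :=
      (PiNat.isTopologicalBasis_cylinders fun _ : ℕ => A).exists_subset_of_mem_open hx hU
    exact mem_iUnion.2 ⟨n, by rw [← PiNat.mem_cylinder_iff_eq.1 hxs] at hsU; exact hsU⟩
  have hle : ∀ n, μ (S n) ≤ C * ν (S n) := fun n => by
    set T : Finset (Fin n → A) :=
      Finset.univ.filter fun a => {y : ℕ → A | ∀ i : Fin n, y i = a i} ⊆ U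
    have hT : S n = (fun (y : ℕ → A) (i : Fin n) => y i) ⁻¹' T := by
      ext x
      have : {y : ℕ → A | ∀ i : Fin n, y i = x i} = PiNat.cylinder x n := by
        ext y
        simp [PiNat.cylinder, Fin.forall_iff]
      simp [S, T, this]
    rw [hT, measure_preimage_restrict, measure_preimage_restrict, Finset.mul_sum]
    refine Finset.sum_le_sum fun a _ => ?_
    -- The hypothesis is about infinite sequences, so a word of length `n` is padded with a fixed
    -- letter; without letters there are no sequences at all.
    rcases isEmpty_or_nonempty A with hA | ⟨⟨a₀⟩⟩
    · have : ∀ s : Set (ℕ → A), s = ∅ := fun s => eq_empty_of_isEmpty s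
      simp [this {y | ∀ i : Fin n, y i = a i}]
    · have := h n (fun l => if hl : l < n then a ⟨l, hl⟩ else a₀)
      have e : {y : ℕ → A | ∀ l < n, y l = if hl : l < n then a ⟨l, hl⟩ else a₀}
          = {y | ∀ i : Fin n, y i = a i} := by
        ext y
        simp only [mem_ofPred_eq, Fin.forall_iff]
        exact forall_congr' fun l => forall_congr' fun hl => by rw [dif_pos hl]
      rwa [e] at this
  rw [← hSU, hS.measure_iUnion, hS.measure_iUnion]
  exact iSup_le fun n => (hle n).trans (mul_le_mul_right (le_iSup (fun n => ν (S n)) n) C)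

/-- The letterwise bounds multiply to one bound `C` valid on all cylinders, hence on open sets. A
null set of the second measure lies in open sets of arbitrarily small measure, and the first measure
of these is small as well. -/
theorem infinitePi_absolutelyContinuous {m m' : ℕ → Measure A}
    [∀ l, IsProbabilityMeasure (m l)] [∀ l, IsProbabilityMeasure (m' l)] {K : ℕ → ℝ≥0} {C : ℝ≥0}
    (h : ∀ l a, m l {a} ≤ K l * m' l {a}) (hK : ∀ n, ∏ l ∈ Finset.range n, K l ≤ C) :
    Measure.infinitePi m ≪ Measure.infinitePi m' := by
  let _ : TopologicalSpace A := ⊥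
  have : DiscreteTopology A := ⟨rfl⟩
  have : BorelSpace A := ⟨by
    rw [borel_eq_top_of_discrete]
    ext s
    exact iff_of_true (.of_discrete) trivial⟩
  have hle : ∀ (n : ℕ) (q : ℕ → A), Measure.infinitePi m {y | ∀ l < n, y l = q l}
      ≤ C * Measure.infinitePi m' {y | ∀ l < n, y l = q l} := fun n q => by
    rw [infinitePi_cylinder_eq, infinitePi_cylinder_eq]
    calc ∏ l ∈ Finset.range n, m l {q l}
        ≤ ∏ l ∈ Finset.range n, (K l * m' l {q l} : ℝ≥0∞) := Finset.prod_le_prod' fun l _ => h l _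
      _ = ((∏ l ∈ Finset.range n, K l : ℝ≥0) : ℝ≥0∞) * ∏ l ∈ Finset.range n, m' l {q l} := by
        rw [Finset.prod_mul_distrib, ENNReal.ofNNReal_finsetProd]
      _ ≤ _ := by gcongr; exact hK n
  intro s hs
  refine le_antisymm (ENNReal.le_of_forall_pos_le_add fun ε hε _ => ?_) zero_le
  -- `C + 1` replaces `C` so that the division is legitimate when `C = 0`.
  have hε' : (ε : ℝ≥0∞) / (C + 1) ≠ 0 := ENNReal.div_ne_zero.2
    ⟨by simpa using hε.ne', by simp⟩
  obtain ⟨U, hsU, hU, hlt⟩ := s.exists_isOpen_lt_of_lt (μ := Measure.infinitePi m')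
    ((ε : ℝ≥0∞) / (C + 1)) (by rw [hs]; exact pos_iff_ne_zero.2 hε')
  calc Measure.infinitePi m s ≤ Measure.infinitePi m U := measure_mono hsU
    _ ≤ C * Measure.infinitePi m' U := measure_isOpen_le_of_cylinder hle hU
    _ ≤ (C + 1) * ((ε : ℝ≥0∞) / (C + 1)) := by gcongr; exact le_self_add
    _ = ε := ENNReal.mul_div_cancel (by simp) (by simp)
    _ ≤ 0 + ε := by rw [zero_add]

/-- The infinite product of the numbers `(1 - d l)⁻¹` converges if `d` is summable. -/
theorem exists_bound_prod_inv_one_sub {d : ℕ → ℝ} (h0 : ∀ l, 0 ≤ d l) (h1 : ∀ l, d l < 1)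
    (hd : Summable d) : ∃ C : ℝ, ∀ n, ∏ l ∈ Finset.range n, (1 - d l)⁻¹ ≤ C := by
  have hpos : ∀ l, 0 < 1 - d l := fun l => sub_pos.2 (h1 l)
  have ha : ∀ l, (1 - d l)⁻¹ = 1 + d l / (1 - d l) := fun l => by
    have := (hpos l).ne'
    field_simp
    ring
  have ha0 : ∀ l, 0 ≤ d l / (1 - d l) := fun l => div_nonneg (h0 l) (hpos l).le
  -- Eventually `d l ≤ 1 / 2`, and then the term is at most `2 * d l`.
  have hs : Summable fun l => d l / (1 - d l) := by
    refine Summable.of_norm_bounded_eventually_nat (hd.mul_left 2) ?_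
    filter_upwards [hd.tendsto_atTop_zero.eventually_le_const (show (0 : ℝ) < 1 / 2 by norm_num)]
      with l hl
    rw [Real.norm_of_nonneg (ha0 l), div_le_iff₀ (hpos l)]
    nlinarith [h0 l]
  refine ⟨Real.exp (∑' l, d l / (1 - d l)), fun n => ?_⟩
  calc ∏ l ∈ Finset.range n, (1 - d l)⁻¹
      ≤ ∏ l ∈ Finset.range n, Real.exp (d l / (1 - d l)) := by
        refine Finset.prod_le_prod (fun l _ => (inv_pos.2 (hpos l)).le) fun l _ => ?_
        rw [ha, add_comm]
        exact Real.add_one_le_exp _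
    _ = Real.exp (∑ l ∈ Finset.range n, d l / (1 - d l)) := (Real.exp_sum _ _).symm
    _ ≤ _ := Real.exp_le_exp.2 (hs.sum_le_tsum _ fun l _ => ha0 l)

end InfiniteProduct

/-! ### The measures on the vertices of `Λ_{2N}` -/

instance (N : ℕ) : MeasurableSpace (StarVertex N) := ⊤

instance (N : ℕ) : DiscreteMeasurableSpace (StarVertex N) := ⟨fun _ => trivial⟩

namespace StarVertex

variable {N : ℕ}

/-- The vertices of the star, as a sum type. -/
def equivOption (N : ℕ) : StarVertex N ≃ Option (Fin N ⊕ Fin N) where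
  toFun
    | .v => none
    | .u j => some (.inl j)
    | .w j => some (.inr j)
  invFun
    | none => .v
    | some (.inl j) => .u j
    | some (.inr j) => .w j
  left_inv a := by cases a <;> rfl
  right_inv a := by rcases a with _ | _ | _ <;> rfl

theorem sum_eq {α : Type*} [AddCommMonoid α] (f : StarVertex N → α) :
    ∑ a, f a = f .v + (∑ j, f (.u j) + ∑ j, f (.w j)) := by
  rw [← (equivOption N).symm.sum_comp, Fintype.sum_option, Fintype.sum_sum_type]
  rfl

theorem abs_alphaAt_le {δ : Fin N → ℕ → ℝ} {B : ℝ} {l : ℕ} (hB : 0 ≤ B) (h : ∀ j, |δ j l| ≤ B)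
    (a : StarVertex N) : |alphaAt δ l a| ≤ B := by
  rcases a with _ | j | j
  · simpa [alphaAt] using hB
  · exact h j
  · simpa [alphaAt] using h j

theorem neg_one_lt_alphaAt {δ : Fin N → ℕ → ℝ} (hδ : ∀ j i, |δ j i| < 1) (l : ℕ)
    (a : StarVertex N) : -1 < alphaAt δ l a := by
  rcases a with _ | j | j
  · simp [alphaAt]
  · exact (abs_lt.1 (hδ j l)).1
  · simpa [alphaAt] using (abs_lt.1 (hδ j l)).2

/-- The probability that the `l`-th vertex of a random path is `a`, if the vertices with index
congruent to `b` modulo `2` are `v`. -/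
def prob (δ : Fin N → ℕ → ℝ) (b l : ℕ) (a : StarVertex N) : ℝ :=
  if l % 2 = b then (if a = .v then 1 else 0)
  else (if a = .v then 0 else (1 + alphaAt δ l a) / (2 * N))

theorem prob_nonneg {δ : Fin N → ℕ → ℝ} (hδ : ∀ j i, |δ j i| < 1) (b l : ℕ) (a : StarVertex N) :
    0 ≤ prob δ b l a := by
  have := neg_one_lt_alphaAt hδ l a
  unfold prob
  split_ifs
  · exact zero_le_one
  · exact le_rfl
  · exact le_rfl
  · exact div_nonneg (by linarith) (by positivity)

/-- The perturbations at `u_j` and `w_j` are opposite and cancel, so each of the `N` pairs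
contributes `1 / N`. -/
theorem sum_prob (hN : 1 ≤ N) (δ : Fin N → ℕ → ℝ) (b l : ℕ) : ∑ a, prob δ b l a = 1 := by
  have hN' : (N : ℝ) ≠ 0 := by positivity
  rw [sum_eq]
  unfold prob
  by_cases h : l % 2 = b
  · simp [h]
  · have : ∀ j, (1 + δ j l) / (2 * N) + (1 + -δ j l) / (2 * N) = (1 : ℝ) / N := fun j => by
      field_simp
      ring
    simp [h, alphaAt, ← Finset.sum_add_distrib, this, hN']

/-- The distribution of the `l`-th vertex. -/
def vertexMeasure (δ : Fin N → ℕ → ℝ) (b l : ℕ) : Measure (StarVertex N) :=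
  ∑ a, ENNReal.ofReal (prob δ b l a) • Measure.dirac a

theorem vertexMeasure_singleton (δ : Fin N → ℕ → ℝ) (b l : ℕ) (a : StarVertex N) :
    vertexMeasure δ b l {a} = ENNReal.ofReal (prob δ b l a) := by
  rw [vertexMeasure, Measure.finsetSum_apply, Finset.sum_eq_single a]
  · simp
  · intro c _ hc
    simp [hc]
  · simp

theorem isProbabilityMeasure_vertexMeasure (hN : 1 ≤ N) {δ : Fin N → ℕ → ℝ}
    (hδ : ∀ j i, |δ j i| < 1) (b l : ℕ) : IsProbabilityMeasure (vertexMeasure δ b l) := by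
  refine ⟨?_⟩
  rw [vertexMeasure, Measure.finsetSum_apply]
  simp only [Measure.smul_apply, measure_univ, smul_eq_mul, mul_one]
  rw [← ENNReal.ofReal_sum_of_nonneg fun a _ => prob_nonneg hδ b l a, sum_prob hN,
    ENNReal.ofReal_one]

/-- A bound for the ratio of the distributions with and without `δ`. -/
def ratioBound (δ : Fin N → ℕ → ℝ) (l : ℕ) : ℝ := ∏ j, (1 - |δ j l|)⁻¹

section Bounds

variable {δ : Fin N → ℕ → ℝ} (hδ : ∀ j i, |δ j i| < 1)

include hδ

theorem one_le_inv_one_sub (j : Fin N) (l : ℕ) : 1 ≤ (1 - |δ j l|)⁻¹ :=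
  (one_le_inv₀ (sub_pos.2 (hδ j l))).2 (by linarith [abs_nonneg (δ j l)])

theorem one_le_prod_inv_one_sub (s : Finset (Fin N)) (l : ℕ) :
    1 ≤ ∏ j ∈ s, (1 - |δ j l|)⁻¹ := by
  calc (1 : ℝ) = ∏ _j ∈ s, 1 := by simp
    _ ≤ _ := Finset.prod_le_prod (fun _ _ => zero_le_one) fun j _ => one_le_inv_one_sub hδ j l

theorem one_le_ratioBound (l : ℕ) : 1 ≤ ratioBound δ l :=
  one_le_prod_inv_one_sub hδ _ l

theorem inv_one_sub_le_ratioBound (j : Fin N) (l : ℕ) : (1 - |δ j l|)⁻¹ ≤ ratioBound δ l := by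
  have h0 : ∀ i, 0 ≤ (1 - |δ i l|)⁻¹ := fun i => zero_le_one.trans (one_le_inv_one_sub hδ i l)
  rw [ratioBound, ← Finset.mul_prod_erase _ _ (Finset.mem_univ j)]
  exact le_mul_of_one_le_right (h0 j) (one_le_prod_inv_one_sub hδ _ l)

/-- With `K = ratioBound δ l`, this rearranges `(1 - |δ j l|)⁻¹ ≤ K`. Both comparisons of `1 + α`
with the unperturbed value `1` are read off from it. -/
theorem abs_alphaAt_le_ratioBound (l : ℕ) (a : StarVertex N) :
    |alphaAt δ l a| ≤ 1 - (ratioBound δ l)⁻¹ := by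
  have h1 := one_le_ratioBound hδ l
  refine abs_alphaAt_le (sub_nonneg.2 (inv_le_one_of_one_le₀ h1)) (fun j => ?_) a
  have := inv_anti₀ (zero_lt_one.trans_le (one_le_inv_one_sub hδ j l))
    (inv_one_sub_le_ratioBound hδ j l)
  rw [inv_inv] at this
  linarith

theorem one_add_alphaAt_le (l : ℕ) (a : StarVertex N) : 1 + alphaAt δ l a ≤ ratioBound δ l := by
  have h1 := one_le_ratioBound hδ l
  have h2 := (abs_le.1 (abs_alphaAt_le_ratioBound hδ l a)).2
  -- By this, `1 + α ≤ 2 - K⁻¹ ≤ K`.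
  have h3 : 2 ≤ ratioBound δ l + (ratioBound δ l)⁻¹ := by
    have h4 : 0 < ratioBound δ l := by linarith
    rw [← sub_nonneg]
    have : ratioBound δ l + (ratioBound δ l)⁻¹ - 2
        = (ratioBound δ l - 1) ^ 2 * (ratioBound δ l)⁻¹ := by
      field_simp
      ring
    rw [this]
    positivity
  linarith

theorem one_le_ratioBound_mul (l : ℕ) (a : StarVertex N) :
    1 ≤ ratioBound δ l * (1 + alphaAt δ l a) := by
  have h1 := one_le_ratioBound hδ l
  have h2 := (abs_le.1 (abs_alphaAt_le_ratioBound hδ l a)).1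
  have h4 : 0 < ratioBound δ l := by linarith
  calc 1 = ratioBound δ l * (ratioBound δ l)⁻¹ := (mul_inv_cancel₀ h4.ne').symm
    _ ≤ _ := by gcongr; linarith

theorem prob_le (b l : ℕ) (a : StarVertex N) :
    prob δ b l a ≤ ratioBound δ l * prob 0 b l a := by
  have h1 := one_le_ratioBound hδ l
  have h2 := one_add_alphaAt_le hδ l a
  unfold prob
  split_ifs with h h' h'
  · linarith
  · simp
  · simp
  · have : alphaAt (0 : Fin N → ℕ → ℝ) l a = 0 := by cases a <;> simp [alphaAt]
    rw [this, add_zero, ← mul_div_assoc, mul_one]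
    gcongr

theorem prob_zero_le (b l : ℕ) (a : StarVertex N) :
    prob 0 b l a ≤ ratioBound δ l * prob δ b l a := by
  have h1 := one_le_ratioBound hδ l
  have h2 := one_le_ratioBound_mul hδ l a
  unfold prob
  split_ifs with h h' h'
  · linarith
  · simp
  · simp
  · have : alphaAt (0 : Fin N → ℕ → ℝ) l a = 0 := by cases a <;> simp [alphaAt]
    rw [this, add_zero, ← mul_div_assoc]
    gcongr

/-- Since the ratio bound is a product over `j` rather than a maximum, the products over `l` and `j`
can be interchanged, and each single sequence is then bounded separately. -/
theorem exists_bound_prod_ratioBound (hsum : ∀ j, Summable fun i => |δ j i|) :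
    ∃ C : ℝ, ∀ n, ∏ l ∈ Finset.range n, ratioBound δ l ≤ C := by
  choose C hC using fun j => exists_bound_prod_inv_one_sub (d := fun l => |δ j l|)
    (fun l => abs_nonneg _) (hδ j) (hsum j)
  refine ⟨∏ j, C j, fun n => ?_⟩
  simp only [ratioBound]
  rw [Finset.prod_comm]
  exact Finset.prod_le_prod (fun j _ => Finset.prod_nonneg fun l _ =>
    zero_le_one.trans (one_le_inv_one_sub hδ j l)) fun j _ => hC j n

theorem infinitePi_vertexMeasure_equivalent (hN : 1 ≤ N) (hsum : ∀ j, Summable fun i => |δ j i|)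
    (b : ℕ) : Measure.infinitePi (vertexMeasure δ b) ≪ Measure.infinitePi (vertexMeasure 0 b) ∧
      Measure.infinitePi (vertexMeasure 0 b) ≪ Measure.infinitePi (vertexMeasure δ b) := by
  have h0 : ∀ (j : Fin N) (i : ℕ), |(0 : Fin N → ℕ → ℝ) j i| < 1 := by simp
  have := isProbabilityMeasure_vertexMeasure hN hδ b
  have := isProbabilityMeasure_vertexMeasure hN h0 b
  obtain ⟨C, hC⟩ := exists_bound_prod_ratioBound hδ hsum
  have hpos : ∀ l, 0 ≤ ratioBound δ l := fun l => zero_le_one.trans (one_le_ratioBound hδ l)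
  have hK : ∀ n, ∏ l ∈ Finset.range n, (ratioBound δ l).toNNReal ≤ C.toNNReal := fun n => by
    rw [← Real.toNNReal_prod_of_nonneg fun l _ => hpos l]
    exact Real.toNNReal_le_toNNReal (hC n)
  constructor
  · refine infinitePi_absolutelyContinuous (fun l a => ?_) hK
    rw [vertexMeasure_singleton, vertexMeasure_singleton, ← ENNReal.ofReal,
      ← ENNReal.ofReal_mul (hpos l)]
    exact ENNReal.ofReal_le_ofReal (prob_le hδ b l a)
  · refine infinitePi_absolutelyContinuous (fun l a => ?_) hK
    rw [vertexMeasure_singleton, vertexMeasure_singleton, ← ENNReal.ofReal,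
      ← ENNReal.ofReal_mul (hpos l)]
    exact ENNReal.ofReal_le_ofReal (prob_zero_le hδ b l a)

end Bounds

theorem ae_prob_pos (hN : 1 ≤ N) {δ : Fin N → ℕ → ℝ} (hδ : ∀ j i, |δ j i| < 1) (b : ℕ) :
    ∀ᵐ y ∂(Measure.infinitePi (vertexMeasure δ b)), ∀ l, prob δ b l (y l) ≠ 0 := by
  have := isProbabilityMeasure_vertexMeasure hN hδ b
  rw [ae_all_iff]
  intro l
  have h : ∀ᵐ a ∂(vertexMeasure δ b l), prob δ b l a ≠ 0 := by
    rw [ae_iff_of_countable]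
    intro a ha ha'
    rw [vertexMeasure_singleton, ha', ENNReal.ofReal_zero] at ha
    exact ha rfl
  exact (measurePreserving_eval_infinitePi (vertexMeasure δ b) l).quasiMeasurePreserving.ae h

/-- Almost every sequence of vertices is a walk. -/
theorem ae_walk (hN : 1 ≤ N) {δ : Fin N → ℕ → ℝ} (hδ : ∀ j i, |δ j i| < 1) {b : ℕ} (hb : b < 2) :
    ∀ᵐ y ∂(Measure.infinitePi (vertexMeasure δ b)), ∀ l, Xor (y l = .v) (y (l + 1) = .v) := by
  filter_upwards [ae_prob_pos hN hδ b] with y hy l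
  have h1 := hy l
  have h2 := hy (l + 1)
  unfold prob at h1 h2
  -- Nonzero probability forces `v` at the times of parity `b` and excludes it at the others; of two
  -- consecutive times exactly one has parity `b`.
  rcases Nat.lt_or_ge (l % 2) 1 with hl | hl <;> interval_cases b
  · rw [if_pos (by omega)] at h1; rw [if_neg (by omega)] at h2
    simp only [ne_eq, ite_eq_right_iff, one_ne_zero, imp_false, not_not] at h1
    exact Or.inl ⟨h1, fun h => h2 (if_pos h)⟩
  · rw [if_neg (by omega)] at h1; rw [if_pos (by omega)] at h2
    simp only [ne_eq, ite_eq_right_iff, one_ne_zero, imp_false, not_not] at h2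
    exact Or.inr ⟨h2, fun h => h1 (if_pos h)⟩
  · rw [if_neg (by omega)] at h1; rw [if_pos (by omega)] at h2
    simp only [ne_eq, ite_eq_right_iff, one_ne_zero, imp_false, not_not] at h2
    exact Or.inr ⟨h2, fun h => h1 (if_pos h)⟩
  · rw [if_pos (by omega)] at h1; rw [if_neg (by omega)] at h2
    simp only [ne_eq, ite_eq_right_iff, one_ne_zero, imp_false, not_not] at h1
    exact Or.inl ⟨h1, fun h => h2 (if_pos h)⟩

end StarVertex

/-! ### Paths in `Λ_{2N}` and walks on the star -/

theorem altPos_zero : altPos 0 = 0 := by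
  ext i; fin_cases i <;> rfl

theorem altPos_two_mul (n : ℕ) : altPos (2 * n) = fun _ => n := by
  ext i; fin_cases i <;> simp [altPos]; omega

/-- The colour added is red, `i = 1`, when `l` is even and blue, `i = 0`, when `l` is odd. -/
theorem altPos_succ (l : ℕ) : ∃ i, altPos (l + 1) = altPos l + Pi.single i 1 := by
  rcases Nat.mod_two_eq_zero_or_one l with h | h
  · refine ⟨1, ?_⟩
    ext i; fin_cases i <;> simp [altPos] <;> omega
  · refine ⟨0, ?_⟩
    ext i; fin_cases i <;> simp [altPos] <;> omega

theorem altPos_mono : Monotone altPos := fun l m h i => by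
  fin_cases i <;> simp [altPos] <;> omega

namespace KGraph

variable {k : ℕ} {V P : Type*} {Λ : KGraph k V P}

theorem vertexAt_zero (a : P) : Λ.vertexAt a 0 = Λ.r a := by
  obtain ⟨-, hd⟩ := Λ.head_tail a 0 zero_le
  rw [vertexAt, Λ.eq_idp hd, Λ.s_idp, Λ.r_head zero_le]

theorem vertexAt_d (a : P) : Λ.vertexAt a (Λ.d a) = Λ.s a := by
  rw [vertexAt, Λ.head_d]

theorem vertexAt_head {a : P} {p q : Fin k → ℕ} (hpq : p ≤ q) (hq : q ≤ Λ.d a) :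
    Λ.vertexAt (Λ.head a q) p = Λ.vertexAt a p := by
  rw [vertexAt, Λ.head_head hpq hq, vertexAt]

/-- A path of degree `p + q` is the product of its initial piece of degree `p` and a path of
degree `q`. -/
theorem exists_comp_head {a : P} {p q : Fin k → ℕ} (h : Λ.d a = p + q) :
    ∃ e, ∃ he : Λ.s (Λ.head a p) = Λ.r e, Λ.comp (Λ.head a p) e he = a ∧ Λ.d e = q ∧
      Λ.d (Λ.head a p) = p ∧ Λ.s e = Λ.s a := by
  obtain ⟨⟨he, e⟩, hd⟩ := Λ.head_tail a p (h ▸ le_self_add)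
  refine ⟨_, he, e, ?_, hd, ?_⟩
  · have := congrArg Λ.d e
    rw [Λ.d_comp, hd, h] at this
    exact add_left_cancel this
  · rw [← Λ.s_comp _ _ he, e]

end KGraph

namespace IsLambda2N

open KGraph

variable {N : ℕ} {P : Type u} {Λ : KGraph 2 (StarVertex N) P} (hΛ : IsLambda2N Λ)

include hΛ

theorem xor_edge {e : P} {i : Fin 2} (he : Λ.d e = Pi.single i 1) :
    Xor (Λ.r e = .v) (Λ.s e = .v) :=
  (hΛ i _ _).2 ⟨e, he, rfl, rfl⟩

theorem edge_unique {e e' : P} {i : Fin 2} (he : Λ.d e = Pi.single i 1)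
    (he' : Λ.d e' = Pi.single i 1) (hr : Λ.r e = Λ.r e') (hs : Λ.s e = Λ.s e') : e = e' :=
  ((hΛ i _ _).1 (hΛ.xor_edge he')).unique ⟨he, hr, hs⟩ ⟨he', rfl, rfl⟩

/-- Induction on the length: the last edges have the same colour and the same end points, hence
coincide. No factorization rule beyond unique factorization is involved. -/
theorem eq_of_vertexAt {m : ℕ} {η η' : P} (h : Λ.d η = altPos m) (h' : Λ.d η' = altPos m)
    (hv : ∀ l ≤ m, Λ.vertexAt η (altPos l) = Λ.vertexAt η' (altPos l)) : η = η' := by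
  induction m generalizing η η' with
  | zero =>
    have hr := hv 0 le_rfl
    rw [altPos_zero, vertexAt_zero, vertexAt_zero] at hr
    rw [Λ.eq_idp (h.trans altPos_zero), Λ.eq_idp (h'.trans altPos_zero), hr]
  | succ m ih =>
    obtain ⟨i, hi⟩ := altPos_succ m
    obtain ⟨e, he, e1, e2, e3, e4⟩ := Λ.exists_comp_head (h.trans hi)
    obtain ⟨e', he', e1', e2', e3', e4'⟩ := Λ.exists_comp_head (h'.trans hi)
    have hle : altPos m ≤ altPos (m + 1) := altPos_mono m.le_succ
    have hh : Λ.head η (altPos m) = Λ.head η' (altPos m) := ih e3 e3' fun l hl => by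
      rw [vertexAt_head (altPos_mono hl) (hle.trans h.ge),
        vertexAt_head (altPos_mono hl) (hle.trans h'.ge), hv l (hl.trans m.le_succ)]
    have hs : Λ.s e = Λ.s e' := by
      have := hv (m + 1) le_rfl
      rwa [← h, vertexAt_d, h, ← h', vertexAt_d, ← e4, ← e4'] at this
    have hee : e = e' := hΛ.edge_unique e2 e2' (by rw [← he, ← he', hh]) hs
    rw [← e1, ← e1']
    exact Λ.comp_congr hh hee _ _

theorem xor_vertexAt {m : ℕ} {η : P} (h : Λ.d η = altPos m) {l : ℕ} (hl : l < m) :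
    Xor (Λ.vertexAt η (altPos l) = .v) (Λ.vertexAt η (altPos (l + 1)) = .v) := by
  obtain ⟨i, hi⟩ := altPos_succ l
  have hle : altPos (l + 1) ≤ Λ.d η := (altPos_mono hl).trans h.ge
  obtain ⟨e, he, e1, e2, e3, e4⟩ :=
    Λ.exists_comp_head (((Λ.head_tail η _ hle).2).trans hi)
  have := hΛ.xor_edge e2
  rwa [← he, e4, head_head (altPos_mono l.le_succ) hle] at this

/-- The vertices on a path alternate between `v` and the other vertices. -/
theorem vertexAt_eq_v_iff {m : ℕ} {η : P} (h : Λ.d η = altPos m) {l : ℕ} (hl : l ≤ m) :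
    Λ.vertexAt η (altPos l) = .v ↔ (l % 2 = 0 ↔ Λ.r η = .v) := by
  induction l with
  | zero => rw [altPos_zero, vertexAt_zero]; simp
  | succ l ih =>
    have h1 := hΛ.xor_vertexAt h (l := l) hl
    have h2 := ih (Nat.le_of_succ_le hl)
    have h3 : (l + 1) % 2 = 0 ↔ ¬ l % 2 = 0 := by omega
    unfold Xor at h1
    tauto

theorem exists_path {y : ℕ → StarVertex N} (hy : ∀ l, Xor (y l = .v) (y (l + 1) = .v)) (m : ℕ) :
    ∃ η, Λ.d η = altPos m ∧ ∀ l ≤ m, Λ.vertexAt η (altPos l) = y l := by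
  induction m with
  | zero =>
    refine ⟨Λ.idp (y 0), by rw [Λ.d_idp, altPos_zero], fun l hl => ?_⟩
    rw [Nat.le_zero.1 hl, altPos_zero, vertexAt_zero, Λ.r_idp]
  | succ m ih =>
    obtain ⟨η, hd, hv⟩ := ih
    obtain ⟨i, hi⟩ := altPos_succ m
    obtain ⟨e, ⟨he, hr, hs⟩, -⟩ := (hΛ i _ _).1 (hy m)
    have hc : Λ.s η = Λ.r e := by
      rw [hr, ← hv m le_rfl, ← hd, vertexAt_d]
    have hdc : Λ.d (Λ.comp η e hc) = altPos (m + 1) := by rw [Λ.d_comp, hd, he, hi]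
    refine ⟨Λ.comp η e hc, hdc, fun l hl => ?_⟩
    rcases Nat.lt_succ_iff_lt_or_eq.1 (Nat.lt_succ_of_le hl) with hl' | rfl
    · have hl'' := Nat.le_of_lt_succ hl'
      rw [← hv l hl'', ← vertexAt_head (altPos_mono hl'')
        ((altPos_mono m.le_succ).trans hdc.ge), Λ.head_eq_of_comp hc rfl hd]
    · rw [← hdc, vertexAt_d, Λ.s_comp, hs]

/-- Every walk on the star is the sequence of vertices of an infinite path. -/
theorem exists_infPath {y : ℕ → StarVertex N} (hy : ∀ l, Xor (y l = .v) (y (l + 1) = .v)) :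
    ∃ x : Λ.InfPath, ∀ l, x.obj (altPos l) = y l := by
  choose H hd hv using hΛ.exists_path hy
  have hH : ∀ {m m'}, m ≤ m' → Λ.head (H m') (altPos m) = H m := fun {m m'} hm => by
    have hle : altPos m ≤ Λ.d (H m') := (altPos_mono hm).trans (hd m').ge
    refine hΛ.eq_of_vertexAt (Λ.head_tail _ _ hle).2 (hd m) fun l hl => ?_
    rw [vertexAt_head (altPos_mono hl) hle, hv m' l (hl.trans hm), hv m l hl]
  -- The staircase passes the diagonal degree `(p 0 + p 1, p 0 + p 1)` at time `B p`, and this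
  -- degree dominates `p`. So the initial piece of degree `p` can be cut from the finite path of
  -- length `B p`.
  set B : (Fin 2 → ℕ) → ℕ := fun p => 2 * (p 0 + p 1)
  have hB : ∀ p, p ≤ altPos (B p) := fun p i => by
    rw [altPos_two_mul]
    fin_cases i <;> simp
  have hBd : ∀ p, p ≤ Λ.d (H (B p)) := fun p => (hB p).trans (hd _).ge
  have hBm : ∀ {p q}, p ≤ q → B p ≤ B q := fun {p q} h => by
    have h0 : p 0 ≤ q 0 := h 0
    have h1 : p 1 ≤ q 1 := h 1
    simp only [B]
    omega
  have hI : ∀ p q, p ≤ q → Λ.head (Λ.head (H (B q)) q) p = Λ.head (H (B p)) p := fun p q h => by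
    rw [head_head h (hBd q), ← hH (hBm h), head_head (hB p)
      ((altPos_mono (hBm h)).trans (hd _).ge)]
  refine ⟨InfPath.ofHeads (fun p => Λ.head (H (B p)) p) (fun p => (Λ.head_tail _ _ (hBd p)).2)
    fun p q h => ?_, fun l => ?_⟩
  · have hq := (Λ.head_tail _ _ (hBd q)).2
    obtain ⟨⟨h1, e1⟩, -⟩ := Λ.head_tail (Λ.head (H (B q)) q) p (h.trans hq.ge)
    rw [hI p q h] at h1
    exact ⟨_, h1, (Λ.comp_congr (hI p q h).symm rfl _ _).trans e1⟩
  · refine hv (B (altPos l)) l ?_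
    simp only [B, altPos, Matrix.cons_val_zero, Matrix.cons_val_one]
    omega

theorem mem_cylinder_iff_vertices {n : ℕ} {η : P} (h : Λ.d η = fun _ => n) {x : Λ.InfPath} :
    x ∈ Λ.cylinder η ↔ ∀ l < 2 * n + 1, x.obj (altPos l) = Λ.vertexAt η (altPos l) := by
  have h' : Λ.d η = altPos (2 * n) := h.trans (altPos_two_mul n).symm
  rw [mem_cylinder_iff h']
  constructor
  · intro hx l hl
    rw [← hx, x.vertexAt_map (altPos_mono (Nat.le_of_lt_succ hl))]
  · intro hx
    refine hΛ.eq_of_vertexAt (x.d_map_zero _) h' fun l hl => ?_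
    rw [x.vertexAt_map (altPos_mono hl), hx l (Nat.lt_succ_of_le hl)]

/-- This map transports product measures from vertex sequences to the path space. Off the measurable
set of walks, which carries the measures used, it is given a constant value. -/
theorem exists_measurable_pathMap (hN : 1 ≤ N) : ∃ Ψ : (ℕ → StarVertex N) → Λ.InfPath,
    Measurable Ψ ∧ ∀ y, (∀ l, Xor (y l = .v) (y (l + 1) = .v)) →
      ∀ l, (Ψ y).obj (altPos l) = y l := by
  classical
  have hne : ∃ x₀ : Λ.InfPath, True := by
    -- The default value is a path that oscillates between `v` and one leaf; a leaf exists because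
    -- `N ≥ 1`.
    obtain ⟨x, -⟩ := hΛ.exists_infPath (y := fun l => if l % 2 = 0 then .v else .u ⟨0, hN⟩)
      fun l => by
        rcases Nat.mod_two_eq_zero_or_one l with h | h
        · have h' : (l + 1) % 2 ≠ 0 := by omega
          exact Or.inl ⟨by simp [h], by simp [h']⟩
        · have h' : (l + 1) % 2 = 0 := by omega
          exact Or.inr ⟨by simp [h'], by simp [h]⟩
    exact ⟨x, trivial⟩
  obtain ⟨x₀, -⟩ := hne
  set W : Set (ℕ → StarVertex N) := {y | ∀ l, Xor (y l = .v) (y (l + 1) = .v)}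
  have hW : MeasurableSet W := by
    have : W = ⋂ l, {y | Xor (y l = .v) (y (l + 1) = .v)} := by ext; simp [W]
    rw [this]
    refine MeasurableSet.iInter fun l => ?_
    have hm : Measurable fun y : ℕ → StarVertex N => (y l, y (l + 1)) :=
      (measurable_pi_apply l).prodMk (measurable_pi_apply (l + 1))
    exact hm (MeasurableSet.of_discrete (s := {q : StarVertex N × StarVertex N |
      Xor (q.1 = .v) (q.2 = .v)}))
  have hex : ∀ y, ∃ x : Λ.InfPath, (y ∈ W → ∀ l, x.obj (altPos l) = y l) ∧ (y ∉ W → x = x₀) := by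
    intro y
    by_cases hy : y ∈ W
    · obtain ⟨x, hx⟩ := hΛ.exists_infPath hy
      exact ⟨x, fun _ => hx, fun h => absurd hy h⟩
    · exact ⟨x₀, fun h => absurd h hy, fun _ => rfl⟩
  choose Ψ h1 h2 using hex
  refine ⟨Ψ, ?_, h1⟩
  refine (measurable_generateFrom (s := Λ.diagonalCylinders) ?_).mono le_rfl
    (generateFrom_diagonalCylinders Λ).le
  rintro _ ⟨n, η, hη, rfl⟩
  have : Ψ ⁻¹' Λ.cylinder η
      = (W ∩ {y | ∀ l < 2 * n + 1, y l = Λ.vertexAt η (altPos l)}) ∪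
        (Wᶜ ∩ {_y | x₀ ∈ Λ.cylinder η}) := by
    ext y
    by_cases hy : y ∈ W
    · simp [hy, hΛ.mem_cylinder_iff_vertices hη, h1 y hy]
    · simp [hy, h2 y hy]
  rw [this]
  refine (hW.inter ?_).union (hW.compl.inter (MeasurableSet.const _))
  have : {y : ℕ → StarVertex N | ∀ l < 2 * n + 1, y l = Λ.vertexAt η (altPos l)}
      = ⋂ l ∈ Finset.range (2 * n + 1), (fun y => y l) ⁻¹' {Λ.vertexAt η (altPos l)} := by
    ext; simp
  rw [this]
  exact Finset.measurableSet_biInter _ fun l _ =>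
    measurable_pi_apply l (measurableSet_singleton _)

end IsLambda2N

/-! ### The product measures -/

section ProductMeasures

open KGraph StarVertex

variable {N : ℕ} {P : Type u} {Λ : KGraph 2 (StarVertex N) P}

theorem prod_range_two_mul_add_one (f : ℕ → ℝ) (n : ℕ) :
    ∏ l ∈ Finset.range (2 * n + 1), f l
      = (∏ i ∈ Finset.Icc 0 n, f (2 * i)) * ∏ i ∈ Finset.Icc 1 n, f (2 * i - 1) := by
  induction n with
  | zero => simp
  | succ n ih =>
    rw [show 2 * (n + 1) + 1 = 2 * n + 1 + 1 + 1 by ring, Finset.prod_range_succ,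
      Finset.prod_range_succ, ih, Finset.prod_Icc_succ_top (by omega),
      Finset.prod_Icc_succ_top (by omega), show 2 * (n + 1) - 1 = 2 * n + 1 by omega,
      show 2 * (n + 1) = 2 * n + 1 + 1 by ring]
    ring

/-- If `η` starts at `v`, the factors at even times are `1` and those at odd times form the weight.
Otherwise the factor at time `0` vanishes. -/
theorem IsLambda2N.prod_prob_zero (hΛ : IsLambda2N Λ) (δ : Fin N → ℕ → ℝ) {n : ℕ} {η : P}
    (h : Λ.d η = fun _ => n) :
    ∏ l ∈ Finset.range (2 * n + 1), prob δ 0 l (Λ.vertexAt η (altPos l))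
      = if Λ.r η = .v then productWeight Λ δ n η else 0 := by
  have h' : Λ.d η = altPos (2 * n) := h.trans (altPos_two_mul n).symm
  split_ifs with hr
  · rw [prod_range_two_mul_add_one, productWeight, if_pos hr]
    have e1 : ∏ i ∈ Finset.Icc 0 n, prob δ 0 (2 * i) (Λ.vertexAt η (altPos (2 * i))) = 1 := by
      refine Finset.prod_eq_one fun i hi => ?_
      have hi' := (Finset.mem_Icc.1 hi).2
      rw [prob, if_pos (by omega), if_pos]
      rw [hΛ.vertexAt_eq_v_iff h' (by omega)]
      simp [hr]
    rw [e1, one_mul]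
    refine Finset.prod_congr rfl fun i hi => ?_
    have hi' := Finset.mem_Icc.1 hi
    rw [prob, if_neg (by omega), if_neg]
    rw [hΛ.vertexAt_eq_v_iff h' (by omega), iff_true_right hr]
    omega
  · refine Finset.prod_eq_zero (Finset.mem_range.2 (Nat.succ_pos _)) ?_
    rw [prob, if_pos rfl, if_neg]
    rwa [altPos_zero, vertexAt_zero]

theorem IsLambda2N.prod_prob_one (hΛ : IsLambda2N Λ) (δ : Fin N → ℕ → ℝ) {n : ℕ} {η : P}
    (h : Λ.d η = fun _ => n) :
    ∏ l ∈ Finset.range (2 * n + 1), prob δ 1 l (Λ.vertexAt η (altPos l))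
      = if Λ.r η = .v then 0 else productWeight Λ δ n η := by
  have h' : Λ.d η = altPos (2 * n) := h.trans (altPos_two_mul n).symm
  split_ifs with hr
  · refine Finset.prod_eq_zero (Finset.mem_range.2 (Nat.succ_pos _)) ?_
    rw [prob, if_neg (by omega), if_pos]
    rwa [altPos_zero, vertexAt_zero]
  · rw [prod_range_two_mul_add_one, productWeight, if_neg hr]
    have e1 : ∏ i ∈ Finset.Icc 1 n, prob δ 1 (2 * i - 1) (Λ.vertexAt η (altPos (2 * i - 1)))
        = 1 := by
      refine Finset.prod_eq_one fun i hi => ?_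
      have hi' := Finset.mem_Icc.1 hi
      rw [prob, if_pos (by omega), if_pos]
      rw [hΛ.vertexAt_eq_v_iff h' (by omega), iff_false_right hr]
      omega
    rw [e1, mul_one]
    refine Finset.prod_congr rfl fun i hi => ?_
    have hi' := Finset.mem_Icc.1 hi
    rw [prob, if_neg (by omega), if_neg]
    rw [hΛ.vertexAt_eq_v_iff h' (by omega)]
    simp [hr]

/-- Almost every sequence is a walk, and on walks the preimage of `Z(η)` is the set of sequences
whose first `2n + 1` terms are the vertices of `η`. -/
theorem IsLambda2N.map_infinitePi_cylinder (hΛ : IsLambda2N Λ) (hN : 1 ≤ N) {δ : Fin N → ℕ → ℝ}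
    (hδ : ∀ j i, |δ j i| < 1) {Ψ : (ℕ → StarVertex N) → Λ.InfPath} (hm : Measurable Ψ)
    (hΨ : ∀ y, (∀ l, Xor (y l = .v) (y (l + 1) = .v)) → ∀ l, (Ψ y).obj (altPos l) = y l)
    {b : ℕ} (hb : b < 2) {n : ℕ} {η : P} (h : Λ.d η = fun _ => n) :
    (Measure.infinitePi (vertexMeasure δ b)).map Ψ (Λ.cylinder η)
      = ENNReal.ofReal (∏ l ∈ Finset.range (2 * n + 1), prob δ b l (Λ.vertexAt η (altPos l))) := by
  have := isProbabilityMeasure_vertexMeasure hN hδ b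
  rw [Measure.map_apply hm (measurableSet_cylinder η),
    ENNReal.ofReal_prod_of_nonneg fun l _ => prob_nonneg hδ b l _]
  simp only [← vertexMeasure_singleton]
  rw [← infinitePi_cylinder_eq]
  refine measure_congr ?_
  filter_upwards [ae_walk hN hδ hb] with y hy
  refine propext ?_
  change Ψ y ∈ Λ.cylinder η ↔ ∀ l < 2 * n + 1, y l = _
  rw [hΛ.mem_cylinder_iff_vertices h]
  simp only [hΨ y hy]

theorem IsProductMeasure.unique {δ : Fin N → ℕ → ℝ} {μ ν : Measure Λ.InfPath}
    (hμ : IsProductMeasure Λ δ μ) (hν : IsProductMeasure Λ δ ν) : μ = ν := by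
  have : Countable (StarVertex N) := Finite.to_countable
  refine measure_ext (fun w => ?_) fun n η h => (hμ n η h).trans (hν n η h).symm
  rw [hμ 0 _ (Λ.d_idp w)]
  exact ENNReal.ofReal_ne_top

theorem IsLambda2N.isProductMeasure (hΛ : IsLambda2N Λ) (hN : 1 ≤ N) {δ : Fin N → ℕ → ℝ}
    (hδ : ∀ j i, |δ j i| < 1) {Ψ : (ℕ → StarVertex N) → Λ.InfPath} (hm : Measurable Ψ)
    (hΨ : ∀ y, (∀ l, Xor (y l = .v) (y (l + 1) = .v)) → ∀ l, (Ψ y).obj (altPos l) = y l) :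
    IsProductMeasure Λ δ ((Measure.infinitePi (vertexMeasure δ 0)).map Ψ
      + (Measure.infinitePi (vertexMeasure δ 1)).map Ψ) := by
  intro n η h
  rw [Measure.add_apply, hΛ.map_infinitePi_cylinder hN hδ hm hΨ two_pos h,
    hΛ.map_infinitePi_cylinder hN hδ hm hΨ one_lt_two h, hΛ.prod_prob_zero δ h,
    hΛ.prod_prob_one δ h]
  split_ifs <;> simp

end ProductMeasures

/-! ### The Perron-Frobenius measure of `Λ_{2N}` -/

namespace IsLambda2N

open KGraph StarVertex

variable {N : ℕ} {P : Type u} {Λ : KGraph 2 (StarVertex N) P} (hΛ : IsLambda2N Λ)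

include hΛ

open Classical in
theorem vertexMatrix_apply (i : Fin 2) (a b : StarVertex N) :
    Λ.vertexMatrix i a b = if Xor (a = .v) (b = .v) then 1 else 0 := by
  rw [vertexMatrix]
  split_ifs with h
  · obtain ⟨e, he, huniq⟩ := (hΛ i a b).1 h
    rw [Nat.card_eq_one_iff_unique]
    exact ⟨⟨fun x y => Subtype.ext ((huniq _ x.2).trans (huniq _ y.2).symm)⟩, ⟨⟨e, he⟩⟩⟩
  · have : IsEmpty {e : P // Λ.d e = Pi.single i 1 ∧ Λ.r e = a ∧ Λ.s e = b} :=
      ⟨fun e => h ((hΛ i a b).2 ⟨e.1, e.2⟩)⟩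
    exact Nat.card_of_isEmpty

theorem mulVec_v {R : Type*} [CommSemiring R] (i : Fin 2) (f : StarVertex N → R) :
    ((Λ.vertexMatrix i).map (Nat.cast : ℕ → R)).mulVec f .v
      = ∑ j, f (.u j) + ∑ j, f (.w j) := by
  classical
  simp [Matrix.mulVec, dotProduct, hΛ.vertexMatrix_apply, StarVertex.sum_eq]

theorem mulVec_of_ne {R : Type*} [CommSemiring R] (i : Fin 2) (f : StarVertex N → R)
    {a : StarVertex N} (ha : a ≠ .v) :
    ((Λ.vertexMatrix i).map (Nat.cast : ℕ → R)).mulVec f a = f .v := by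
  classical
  simp [Matrix.mulVec, dotProduct, hΛ.vertexMatrix_apply, ha]

/-- For an eigenvector `f`, the equations at the leaves give `f(v) = z f(a)`; substituting them into
the equation at `v` gives `z² = 2N` unless `z = 0`. The value `√(2N)` is attained by the vector
equal to `√(2N)` at `v` and `1` on the leaves. -/
theorem rho_eq (hN : 1 ≤ N) (i : Fin 2) : Λ.rho i = √(2 * N) := by
  set A := (Λ.vertexMatrix i).map (Nat.cast : ℕ → ℂ)
  have hspec : ∀ z, z ∈ spectrum ℂ A ↔ ∃ f ≠ 0, A.mulVec f = z • f := fun z => by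
    rw [← Matrix.spectrum_toLin', ← Module.End.hasEigenvalue_iff_mem_spectrum]
    constructor
    · intro h
      obtain ⟨f, hf⟩ := h.exists_hasEigenvector
      exact ⟨f, hf.2, by simpa using hf.apply_eq_smul⟩
    · rintro ⟨f, hf, h⟩
      exact Module.End.hasEigenvalue_of_hasEigenvector (x := f)
        (Module.End.hasEigenvector_iff.2 ⟨Module.End.mem_eigenspace_iff.2 (by simpa using h), hf⟩)
  have hs : spectralRadius ℂ A = ENNReal.ofReal √(2 * N) := by
    apply le_antisymm
    · refine iSup₂_le fun z hz => ?_
      obtain ⟨f, hf, h⟩ := (hspec z).1 hz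
      have hv := congrFun h .v
      rw [hΛ.mulVec_v] at hv
      have hu : ∀ a, a ≠ .v → f .v = z * f a := fun a ha => by
        have := congrFun h a
        rwa [hΛ.mulVec_of_ne i f ha] at this
      -- The case `z = 0` does occur: take vectors on the leaves with sum zero.
      have hz2 : z = 0 ∨ z ^ 2 = 2 * N := by
        by_cases hz0 : z = 0
        · exact Or.inl hz0
        right
        have hfv : f .v ≠ 0 := fun h0 => hf <| funext fun a => by
          by_cases ha : a = .v
          · rw [ha, h0]; rfl
          · have := hu a ha
            rw [h0, eq_comm, mul_eq_zero] at this
            exact this.resolve_left hz0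
        have : z * (z * f .v) = 2 * N * f .v := by
          rw [← smul_eq_mul z (f .v), ← Pi.smul_apply, ← hv, mul_add, Finset.mul_sum,
            Finset.mul_sum, Finset.sum_congr rfl fun j _ => (hu (.u j) (by simp)).symm,
            Finset.sum_congr rfl fun j _ => (hu (.w j) (by simp)).symm]
          simp
          ring
        exact mul_right_cancel₀ hfv (by rw [← this]; ring)
      have hn : ‖z‖ ≤ √(2 * N) := by
        rcases hz2 with rfl | h2
        · simp
        · refine Real.le_sqrt_of_sq_le ?_
          rw [← norm_pow, h2]
          simp
      rw [← enorm_eq_nnnorm, ← ofReal_norm]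
      exact ENNReal.ofReal_le_ofReal hn
    · have hmem : ((√(2 * N) : ℝ) : ℂ) ∈ spectrum ℂ A := by
        refine (hspec _).2 ⟨fun a => if a = .v then ((√(2 * N) : ℝ) : ℂ) else 1, ?_, ?_⟩
        · intro h0
          have := congrFun h0 (.u ⟨0, hN⟩)
          simp at this
        · ext a
          by_cases ha : a = .v
          · subst ha
            rw [hΛ.mulVec_v]
            have : ((√(2 * N) : ℝ) : ℂ) * ((√(2 * N) : ℝ) : ℂ) = 2 * N := by
              rw [← Complex.ofReal_mul, Real.mul_self_sqrt (by positivity)]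
              simp
            rw [Pi.smul_apply, smul_eq_mul, if_pos rfl, this]
            simp
            ring
          · rw [hΛ.mulVec_of_ne i _ ha]
            simp [ha]
      refine le_trans ?_ (le_iSup₂ (f := fun z _ => (‖z‖₊ : ℝ≥0∞)) _ hmem)
      rw [← enorm_eq_nnnorm, ← ofReal_norm, Complex.norm_real,
        Real.norm_of_nonneg (Real.sqrt_nonneg _)]
  rw [rho, hs, ENNReal.toReal_ofReal (Real.sqrt_nonneg _)]

/-- The Perron-Frobenius vector. -/
theorem isPerronFrobeniusVector_iff (hN : 1 ≤ N) (κ : StarVertex N → ℝ) :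
    Λ.IsPerronFrobeniusVector κ ↔
      ∀ a, κ a = if a = .v then (1 + √(2 * N))⁻¹ else (√(2 * N) * (1 + √(2 * N)))⁻¹ := by
  have hN' : (0 : ℝ) < 2 * N := by positivity
  set ρ := √(2 * N)
  have hρ : 0 < ρ := Real.sqrt_pos.2 hN'
  have hρ2 : ρ * ρ = 2 * N := Real.mul_self_sqrt hN'.le
  constructor
  · rintro ⟨-, hsum, hA⟩
    -- One colour suffices: its equations at the leaves, together with total mass `1`, determine
    -- `κ`.
    have hu : ∀ a, a ≠ .v → κ a = κ .v / ρ := fun a ha => by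
      have := congrFun (hA 0) a
      rw [hΛ.mulVec_of_ne 0 κ ha, hΛ.rho_eq hN, Pi.smul_apply, smul_eq_mul] at this
      rw [this]
      change _ = ρ * _ / ρ
      field_simp
    have hv : κ .v = (1 + ρ)⁻¹ := by
      rw [StarVertex.sum_eq, Finset.sum_congr rfl fun j _ => hu (.u j) (by simp),
        Finset.sum_congr rfl fun j _ => hu (.w j) (by simp)] at hsum
      simp only [Finset.sum_const, Finset.card_univ, Fintype.card_fin, nsmul_eq_mul] at hsum
      have : κ .v + (N * (κ .v / ρ) + N * (κ .v / ρ)) = κ .v * (1 + ρ) := by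
        have : N * (κ .v / ρ) + N * (κ .v / ρ) = (2 * N) * κ .v / ρ := by ring
        rw [this, ← hρ2]
        field_simp
      rw [this] at hsum
      exact eq_inv_of_mul_eq_one_left hsum
    intro a
    split_ifs with ha
    · rw [ha, hv]
    · rw [hu a ha, hv, mul_inv]
      ring
  · intro h
    refine ⟨fun a => ?_, ?_, fun i => ?_⟩
    · rw [h]
      split_ifs <;> positivity
    · rw [StarVertex.sum_eq]
      simp only [h, if_true, reduceCtorEq, if_false, Finset.sum_const, Finset.card_univ,
        Fintype.card_fin, nsmul_eq_mul]
      have : (N : ℝ) * (ρ * (1 + ρ))⁻¹ + N * (ρ * (1 + ρ))⁻¹ = ρ * ρ * (ρ * (1 + ρ))⁻¹ := by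
        rw [hρ2]; ring
      rw [this]
      field_simp
    · ext a
      rw [hΛ.rho_eq hN, Pi.smul_apply, smul_eq_mul]
      by_cases ha : a = .v
      · subst ha
        rw [hΛ.mulVec_v]
        simp only [h, if_true, reduceCtorEq, if_false, Finset.sum_const, Finset.card_univ,
          Fintype.card_fin, nsmul_eq_mul]
        have : (N : ℝ) * (ρ * (1 + ρ))⁻¹ + N * (ρ * (1 + ρ))⁻¹ = ρ * ρ * (ρ * (1 + ρ))⁻¹ := by
          rw [hρ2]; ring
        rw [this]
        change _ = ρ * _
        field_simp
      · rw [hΛ.mulVec_of_ne i κ ha, h, h, if_pos rfl, if_neg ha]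
        change _ = ρ * _
        field_simp

/-- If the formula for the Perron-Frobenius measure holds for the paths of degree `p + e_i`,
then it holds for the paths of degree `p`. -/
theorem perronFrobenius_of_add_single {κ : StarVertex N → ℝ} (hκ : Λ.IsPerronFrobeniusVector κ)
    (hρ : ∀ i, 0 < Λ.rho i) {M : Measure Λ.InfPath} {p : Fin 2 → ℕ} (i : Fin 2)
    (h : ∀ a, Λ.d a = p + Pi.single i 1 →
      M (Λ.cylinder a) = ENNReal.ofReal ((∏ i, (Λ.rho i)⁻¹ ^ Λ.d a i) * κ (Λ.s a)))
    {a : P} (ha : Λ.d a = p) :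
    M (Λ.cylinder a) = ENNReal.ofReal ((∏ i, (Λ.rho i)⁻¹ ^ Λ.d a i) * κ (Λ.s a)) := by
  classical
  set S := {w : StarVertex N // Xor (Λ.s a = .v) (w = .v)}
  choose e he _ using fun w : S => (hΛ i (Λ.s a) w.1).1 w.2
  have hc : ∀ w : S, Λ.s a = Λ.r (e w) := fun w => (he w).2.1.symm
  have hd : ∀ w : S, Λ.d (Λ.comp a (e w) (hc w)) = p + Pi.single i 1 := fun w => by
    rw [Λ.d_comp, ha, (he w).1]
  -- A path in `Z(a)` is classified by the edge of colour `i` that follows `a`, hence by the source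
  -- of that edge. Summing `κ` over these sources gives a row of `A_i κ = ρ_i κ`.
  have hU : Λ.cylinder a = ⋃ w : S, Λ.cylinder (Λ.comp a (e w) (hc w)) := by
    ext x
    simp only [mem_iUnion, mem_cylinder_comp]
    refine ⟨fun hx => ?_, fun ⟨_, hx⟩ => hx.1⟩
    set f := (x.shift (Λ.d a)).map 0 (Pi.single i 1) zero_le
    have hfd : Λ.d f = Pi.single i 1 := InfPath.d_map_zero _ _
    have hfr : Λ.r f = Λ.s a := by
      rw [← obj_d_of_mem_cylinder hx, ← x.shift_obj_zero]
      exact (x.shift (Λ.d a)).r_map _ _ _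
    have hfx := hΛ.xor_edge hfd
    rw [hfr] at hfx
    refine ⟨⟨Λ.s f, hfx⟩, hx, ?_⟩
    rw [← hΛ.edge_unique hfd (he ⟨Λ.s f, hfx⟩).1 (hfr.trans (he ⟨Λ.s f, hfx⟩).2.1.symm)
      (he ⟨Λ.s f, hfx⟩).2.2.symm]
    exact InfPath.mem_cylinder_map _ _
  have hdisj : Pairwise fun w w' : S => Disjoint (Λ.cylinder (Λ.comp a (e w) (hc w)))
      (Λ.cylinder (Λ.comp a (e w') (hc w'))) := fun w w' hww =>
    disjoint_cylinder ((hd w).trans (hd w').symm) fun h' => hww <| Subtype.ext <| by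
      rw [← (he w).2.2, ← (he w').2.2, ← Λ.s_comp a (e w) (hc w), h', Λ.s_comp]
  have hsum : ∑ w : S, κ w = Λ.rho i * κ (Λ.s a) := by
    have := congrFun (hκ.2.2 i) (Λ.s a)
    rw [Pi.smul_apply, smul_eq_mul] at this
    rw [← this, Matrix.mulVec, dotProduct]
    simp only [Matrix.map_apply, hΛ.vertexMatrix_apply, Nat.cast_ite, Nat.cast_one, Nat.cast_zero,
      ite_mul, one_mul, zero_mul]
    rw [← Finset.sum_filter]
    exact (Finset.sum_subtype _ (by simp) _).symm
  have hprod : ∀ w : S, ∏ j, (Λ.rho j)⁻¹ ^ Λ.d (Λ.comp a (e w) (hc w)) j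
      = (∏ j, (Λ.rho j)⁻¹ ^ Λ.d a j) * (Λ.rho i)⁻¹ := fun w => by
    rw [hd, ha]
    simp only [Pi.add_apply, pow_add, Finset.prod_mul_distrib]
    congr 1
    rw [Finset.prod_eq_single i]
    · simp
    · intro j _ hj
      simp [hj]
    · simp
  have hnn : 0 ≤ ∏ j, (Λ.rho j)⁻¹ ^ Λ.d a j :=
    Finset.prod_nonneg fun j _ => pow_nonneg (inv_nonneg.2 (hρ j).le) _
  rw [hU, measure_iUnion hdisj fun w => measurableSet_cylinder _, tsum_fintype]
  simp only [fun w => h _ (hd w), hprod, Λ.s_comp, fun w => (he w).2.2]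
  rw [← ENNReal.ofReal_sum_of_nonneg fun w _ => mul_nonneg (mul_nonneg hnn
    (inv_nonneg.2 (hρ i).le)) (hκ.1 _).le, ← Finset.mul_sum, hsum]
  congr 1
  have := (hρ i).ne'
  field_simp

theorem perronFrobenius_of_diagonal {κ : StarVertex N → ℝ} (hκ : Λ.IsPerronFrobeniusVector κ)
    (hρ : ∀ i, 0 < Λ.rho i) {M : Measure Λ.InfPath}
    (h : ∀ n a, Λ.d a = (fun _ => n) →
      M (Λ.cylinder a) = ENNReal.ofReal ((∏ i, (Λ.rho i)⁻¹ ^ Λ.d a i) * κ (Λ.s a))) (a : P) :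
    M (Λ.cylinder a) = ENNReal.ofReal ((∏ i, (Λ.rho i)⁻¹ ^ Λ.d a i) * κ (Λ.s a)) := by
  have key : ∀ (i : Fin 2) (t : ℕ) (p : Fin 2 → ℕ), (∀ a, Λ.d a = p + t • Pi.single i 1 →
      M (Λ.cylinder a) = ENNReal.ofReal ((∏ i, (Λ.rho i)⁻¹ ^ Λ.d a i) * κ (Λ.s a))) →
      ∀ a, Λ.d a = p →
        M (Λ.cylinder a) = ENNReal.ofReal ((∏ i, (Λ.rho i)⁻¹ ^ Λ.d a i) * κ (Λ.s a)) := by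
    intro i t
    induction t with
    | zero => intro p h a ha; exact h a (by simpa using ha)
    | succ t ih =>
      intro p h
      refine ih p fun a ha => hΛ.perronFrobenius_of_add_single hκ hρ i (fun b hb => h b ?_) ha
      rw [hb, succ_nsmul, add_assoc]
  -- Extending degree `(p, q)` by `q` edges of colour `0` and `p` of colour `1` reaches the diagonal
  -- degree `(p + q, p + q)`.
  refine key 0 (Λ.d a 1) (Λ.d a) (fun b hb => key 1 (Λ.d a 0) _ (fun c hc =>
    h (Λ.d a 0 + Λ.d a 1) c ?_) b hb) a rfl
  rw [hc]
  ext i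
  fin_cases i <;> simp [add_comm]

end IsLambda2N

/-! ### Existence, uniqueness and scaling of the Perron–Frobenius measure, and its equivalence with
the product measure -/

namespace IsLambda2N

open KGraph StarVertex

variable {N : ℕ} {P : Type u} {Λ : KGraph 2 (StarVertex N) P} (hΛ : IsLambda2N Λ)

include hΛ

theorem rho_pos (hN : 1 ≤ N) (i : Fin 2) : 0 < Λ.rho i := by
  rw [hΛ.rho_eq hN]
  exact Real.sqrt_pos.2 (by positivity)

theorem perronFrobeniusMeasure_unique (hN : 1 ≤ N) {M M' : Measure Λ.InfPath}
    (hM : Λ.IsPerronFrobeniusMeasure M) (hM' : Λ.IsPerronFrobeniusMeasure M') : M = M' := by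
  have : Countable (StarVertex N) := Finite.to_countable
  obtain ⟨κ, hκ, h⟩ := hM
  obtain ⟨κ', hκ', h'⟩ := hM'
  have e : κ = κ' := funext fun a => by
    rw [(hΛ.isPerronFrobeniusVector_iff hN κ).1 hκ, (hΛ.isPerronFrobeniusVector_iff hN κ').1 hκ']
  subst e
  refine measure_ext (fun w => ?_) fun n a _ => (h a).trans (h' a).symm
  rw [h]
  exact ENNReal.ofReal_ne_top

/-- The two coefficients are the masses of the paths with range `v` and of those with range a leaf,
namely `κ_v` and `2N` times the common value of `κ` on the leaves. -/
theorem isPerronFrobeniusMeasure (hN : 1 ≤ N) {Ψ : (ℕ → StarVertex N) → Λ.InfPath}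
    (hm : Measurable Ψ)
    (hΨ : ∀ y, (∀ l, Xor (y l = .v) (y (l + 1) = .v)) → ∀ l, (Ψ y).obj (altPos l) = y l) :
    Λ.IsPerronFrobeniusMeasure
      (ENNReal.ofReal (1 + √(2 * N))⁻¹ • (Measure.infinitePi (vertexMeasure 0 0)).map Ψ
        + ENNReal.ofReal (√(2 * N) * (1 + √(2 * N))⁻¹) •
          (Measure.infinitePi (vertexMeasure 0 1)).map Ψ) := by
  have h0 : ∀ (j : Fin N) (i : ℕ), |(0 : Fin N → ℕ → ℝ) j i| < 1 := by simp
  have hα : ∀ l (a : StarVertex N), alphaAt (0 : Fin N → ℕ → ℝ) l a = 0 := fun l a => by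
    cases a <;> simp [alphaAt]
  have hN' : (0 : ℝ) < 2 * N := by positivity
  have hρ : 0 < √(2 * N : ℝ) := Real.sqrt_pos.2 hN'
  have hρ2 : √(2 * N : ℝ) * √(2 * N) = 2 * N := Real.mul_self_sqrt hN'.le
  refine ⟨_, (hΛ.isPerronFrobeniusVector_iff hN _).2 fun a => rfl, ?_⟩
  refine hΛ.perronFrobenius_of_diagonal ((hΛ.isPerronFrobeniusVector_iff hN _).2 fun a => rfl)
    (hΛ.rho_pos hN) fun n η h => ?_
  have h' : Λ.d η = altPos (2 * n) := h.trans (altPos_two_mul n).symm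
  -- A path of degree `(n, n)` has even length `2n`, so its two ends have the same type.
  have hs : Λ.s η = .v ↔ Λ.r η = .v := by
    rw [← vertexAt_d, h', hΛ.vertexAt_eq_v_iff h' le_rfl]
    simp
  have hprod : ∏ i, (Λ.rho i)⁻¹ ^ Λ.d η i = (2 * N : ℝ)⁻¹ ^ n := by
    rw [Fin.prod_univ_two, hΛ.rho_eq hN, hΛ.rho_eq hN, h, ← mul_pow, ← mul_inv, hρ2]
  rw [Measure.add_apply, Measure.smul_apply, Measure.smul_apply, smul_eq_mul, smul_eq_mul,
    hΛ.map_infinitePi_cylinder hN h0 hm hΨ two_pos h,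
    hΛ.map_infinitePi_cylinder hN h0 hm hΨ one_lt_two h, hΛ.prod_prob_zero 0 h,
    hΛ.prod_prob_one 0 h, hprod]
  by_cases hr : Λ.r η = .v
  · rw [if_pos hr, if_pos hr, if_pos (hs.2 hr), ENNReal.ofReal_zero, mul_zero, add_zero,
      ← ENNReal.ofReal_mul (by positivity), productWeight, if_pos hr]
    congr 1
    simp only [hα, add_zero, Finset.prod_const, Nat.card_Icc, one_div, Nat.add_sub_cancel]
    ring
  · rw [if_neg hr, if_neg hr, if_neg (fun h => hr (hs.1 h)), ENNReal.ofReal_zero, mul_zero,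
      zero_add, ← ENNReal.ofReal_mul (by positivity), productWeight, if_neg hr]
    congr 1
    simp only [hα, add_zero, Finset.prod_const, Nat.card_Icc, one_div, Nat.sub_zero, pow_succ]
    generalize √(2 * N : ℝ) = ρ at hρ hρ2
    rw [← hρ2]
    field_simp

theorem isScaling (hN : 1 ≤ N) {M : Measure Λ.InfPath} (hM : Λ.IsPerronFrobeniusMeasure M) :
    IsScaling M fun a => (∏ i, (Λ.rho i)⁻¹ ^ Λ.d a i).toNNReal where
  ne_zero a := by
    rw [ne_eq, Real.toNNReal_eq_zero, not_le]
    exact Finset.prod_pos fun i _ => pow_pos (inv_pos.2 (hΛ.rho_pos hN i)) _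
  comp a b h := by
    rw [← Real.toNNReal_mul (Finset.prod_nonneg fun i _ =>
      pow_nonneg (inv_nonneg.2 (hΛ.rho_pos hN i).le) _), Λ.d_comp, ← Finset.prod_mul_distrib]
    simp only [Pi.add_apply, pow_add]
  measure_comp a b h := by
    obtain ⟨κ, -, hκ⟩ := hM
    rw [hκ, hκ, ← ENNReal.ofReal, ← ENNReal.ofReal_mul (Finset.prod_nonneg fun i _ =>
      pow_nonneg (inv_nonneg.2 (hΛ.rho_pos hN i).le) _), Λ.d_comp, Λ.s_comp, ← mul_assoc,
      ← Finset.prod_mul_distrib]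
    simp only [Pi.add_apply, pow_add]

omit hΛ in
theorem isFiniteMeasure_of_cylinder {μ : Measure Λ.InfPath}
    (h : ∀ w, μ (Λ.cylinder (Λ.idp w)) ≠ ∞) : IsFiniteMeasure μ := by
  have hU : (univ : Set Λ.InfPath) = ⋃ w, Λ.cylinder (Λ.idp w) :=
    (eq_univ_of_forall fun x => mem_iUnion.2 ⟨x.obj 0, mem_cylinder_idp.2 rfl⟩).symm
  refine ⟨?_⟩
  rw [hU]
  refine (measure_iUnion_le _).trans_lt ?_
  rw [tsum_fintype]
  exact ENNReal.sum_lt_top.2 fun w _ => (h w).lt_top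

/-- The product measure and the Perron-Frobenius measure are equivalent. -/
theorem equivalent (hN : 1 ≤ N) {δ : Fin N → ℕ → ℝ} (hδ : ∀ j i, |δ j i| < 1)
    (hsum : ∀ j, Summable fun i => |δ j i|) {μ M : Measure Λ.InfPath}
    (hμ : IsProductMeasure Λ δ μ) (hM : Λ.IsPerronFrobeniusMeasure M) : μ ≪ M ∧ M ≪ μ := by
  obtain ⟨Ψ, hm, hΨ⟩ := hΛ.exists_measurable_pathMap hN
  -- By uniqueness both measures take their explicit forms, and the two parities are then compared
  -- separately; positive coefficients do not affect null sets.
  rw [hμ.unique (hΛ.isProductMeasure hN hδ hm hΨ),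
    hΛ.perronFrobeniusMeasure_unique hN hM (hΛ.isPerronFrobeniusMeasure hN hm hΨ)]
  have hN' : (0 : ℝ) < 2 * N := by positivity
  have hρ : 0 < √(2 * N : ℝ) := Real.sqrt_pos.2 hN'
  have h0 : ENNReal.ofReal (1 + √(2 * N))⁻¹ ≠ 0 := by
    rw [ne_eq, ENNReal.ofReal_eq_zero, not_le]; positivity
  have h1 : ENNReal.ofReal (√(2 * N) * (1 + √(2 * N))⁻¹) ≠ 0 := by
    rw [ne_eq, ENNReal.ofReal_eq_zero, not_le]; positivity
  have e0 := infinitePi_vertexMeasure_equivalent hδ hN hsum 0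
  have e1 := infinitePi_vertexMeasure_equivalent hδ hN hsum 1
  exact ⟨((e0.1.map hm).trans (Measure.absolutelyContinuous_smul h0)).add
      ((e1.1.map hm).trans (Measure.absolutelyContinuous_smul h1)),
    (Measure.smul_absolutelyContinuous.trans (e0.2.map hm)).add
      (Measure.smul_absolutelyContinuous.trans (e1.2.map hm))⟩

end IsLambda2N

end

/-! ### The main theorem -/

theorem mainTheorem11 {N : ℕ} (hN : 1 ≤ N) {P : Type*} (Λ : KGraph 2 (StarVertex N) P)
    (hΛ : IsLambda2N Λ) (δ : Fin N → ℕ → ℝ) (hδ : ∀ j i, |δ j i| < 1)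
    (hsum : ∀ j, Summable fun i => |δ j i|) :
    (∃! μ : Measure Λ.InfPath, IsProductMeasure Λ δ μ) ∧
    (∃! M : Measure Λ.InfPath, Λ.IsPerronFrobeniusMeasure M) ∧
    ∀ μ M : Measure Λ.InfPath, IsProductMeasure Λ δ μ → Λ.IsPerronFrobeniusMeasure M →
      (μ ≪ M ∧ M ≪ μ) ∧
      Λ.StandardSemibranching μ ∧
      Λ.StandardSemibranching M ∧
      (∃! π : Λ.cstar →⋆ₙₐ[ℂ] (Lp ℂ 2 μ →L[ℂ] Lp ℂ 2 μ), Λ.IsStandardRep μ π) ∧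
      (∃! π : Λ.cstar →⋆ₙₐ[ℂ] (Lp ℂ 2 M →L[ℂ] Lp ℂ 2 M), Λ.IsStandardRep M π) ∧
      ∀ (π : Λ.cstar →⋆ₙₐ[ℂ] (Lp ℂ 2 μ →L[ℂ] Lp ℂ 2 μ))
        (ρ : Λ.cstar →⋆ₙₐ[ℂ] (Lp ℂ 2 M →L[ℂ] Lp ℂ 2 M)),
        Λ.IsStandardRep μ π → Λ.IsStandardRep M ρ → UnitarilyEquivalent π ρ := by
  have : Countable (StarVertex N) := Finite.to_countable
  obtain ⟨Ψ, hm, hΨ⟩ := hΛ.exists_measurable_pathMap hN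
  refine ⟨⟨_, hΛ.isProductMeasure hN hδ hm hΨ, fun ν hν =>
      hν.unique (hΛ.isProductMeasure hN hδ hm hΨ)⟩,
    ⟨_, hΛ.isPerronFrobeniusMeasure hN hm hΨ, fun M hM =>
      hΛ.perronFrobeniusMeasure_unique hN hM (hΛ.isPerronFrobeniusMeasure hN hm hΨ)⟩, ?_⟩
  intro μ M hμ hM
  have hS := hΛ.isScaling hN hM
  have hac := hΛ.equivalent hN hδ hsum hμ hM
  obtain ⟨κ, hκ, hMκ⟩ := hM
  have : IsFiniteMeasure M := IsLambda2N.isFiniteMeasure_of_cylinder fun w => by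
    rw [hMκ]; exact ENNReal.ofReal_ne_top
  have : IsFiniteMeasure μ := IsLambda2N.isFiniteMeasure_of_cylinder fun w => by
    rw [hμ 0 _ (Λ.d_idp w)]; exact ENNReal.ofReal_ne_top
  have hpos : ∀ w, 0 < M (Λ.cylinder (Λ.idp w)) := fun w => by
    rw [hMκ]
    exact ENNReal.ofReal_pos.2 (mul_pos (Finset.prod_pos fun i _ =>
      pow_pos (inv_pos.2 (hΛ.rho_pos hN i)) _) (hκ.1 _))
  obtain ⟨h, hh, h0, hμh⟩ := exists_density hac.1 hac.2
  have h1 : Measurable fun _ : Λ.InfPath => (1 : NNReal) := measurable_const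
  have hM1 : M = M.withDensity fun _ => ((1 : NNReal) : ℝ≥0∞) := withDensity_one.symm
  exact ⟨hac, hS.standardSemibranching hpos hh h0 hμh,
    hS.standardSemibranching hpos h1 (fun _ => one_ne_zero) hM1,
    hS.existsUnique_standardRep hh h0 hμh,
    hS.existsUnique_standardRep h1 (fun _ => one_ne_zero) hM1,
    fun π ρ hπ hρ => hS.unitarilyEquivalent hh h0 hμh hπ hρ⟩
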